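/- Let $F$ be a non-Archimedean local field with ring of integers $\mathfrak o$, maximal ideal $\mathfrak p$, uniformiser $\varpi$ and residue field $\mathbb F_q$, and let $\psi:F\to\mathbb C^\times$ be an additive character that is trivial on $\mathfrak o$ but not on $\mathfrak p^{-1}$. Let $N\ge 1$, let $r\ge 3$ be odd, $l'=(r-1)/2$, $\mathfrak o_r=\mathfrak o/\mathfrak p^r$, $\mathfrak g_r=\mathrm M_N(\mathfrak o_r)$, $G_r=\mathrm{GL}_N(\mathfrak o_r)$. Let $\beta\in\mathfrak g_r$ be regular, i.e. its centraliser in $\mathfrak g_r$ is free of rank $N$ over $\mathfrak o_r$, and let $\prod_{i=1}^h f_i^{m_i}$ be the characteristic polynomial of its reduction modulo $\mathfrak p$, where $m_i\ge1$ and the $f_i\in\mathbb F_q[x]$ are distinct, monic and irreducible, of degree $d_i$. Let $\mathfrak A_{\mathrm M}=\mathfrak g_r$ with radical $\mathfrak P_{\mathrm M}=\mathfrak p\mathfrak g_r$ and $e_{\mathrm M}=1$. Let $\mathfrak A_{\mathrm m}\subseteq\mathfrak g_r$ be the algebra of matrices that are block upper-triangular modulo $\mathfrak p$, with block sizes $d_1$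 ($m_1$ times), $\dots$, $d_h$ ($m_h$ times) in this order; its radical $\mathfrak P_{\mathrm m}$ consists of the matrices that are strictly block upper-triangular modulo $\mathfrak p$, and $e_{\mathrm m}=m_1+\dots+m_h$. Assume that $\beta\in\mathfrak A_{\mathrm m}$ and that the image of $\beta$ in $\mathfrak A_{\mathrm m}/\mathfrak P_{\mathrm m}\cong\prod_i\mathrm M_{d_i}(\mathbb F_q)^{m_i}$ is $\beta^1\oplus\dots\oplus\beta^1\oplus\dots\oplus\beta^h\oplus\dots\oplus\beta^h$, with $\beta^i$ repeated $m_i$ times and of characteristic polynomial $f_i$. For $\mathfrak A\in\{\mathfrak A_{\mathrm m},\mathfrak A_{\mathrm M}\}$, with $\mathfrak P$ and $e$ correspondingly, put $U^k=1+\mathfrak P^k$ ($k\ge1$), $C=C_{G_r}(\beta)$, $J^1=(C\cap U^1)U^{el'}$ and $H^1=(C\cap U^1)U^{el'+1}$. Let $\theta:H^1\to\mathbb C^\times$ be a character that extends the character $\psi_\beta(1+x)=\psi(\varpi^{-r}\operatorname{tr}(\beta x))$ of $U^{el'+1}$; it is denoted $\theta_{\mathrm m}$ or $\theta_{\mathrm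 M}$ according to the choice of $\mathfrak A$. Then $H^1$ is normal in $J^1$, and $h_\beta(xH^1,yH^1)=\theta(xyx^{-1}y^{-1})$ is a well-defined bimultiplicative form $J^1/H^1\times J^1/H^1\to\mathbb C^\times$. Let $R_\beta\subseteq J^1$ be the preimage of its radical. The following hold. (i) $\displaystyle [J^1:R_\beta]=\left|\frac{\mathfrak A/\mathfrak P}{C_{\mathfrak A/\mathfrak P}(\beta+\mathfrak P)}\right|$. (ii) If $\mathfrak A=\mathfrak A_{\mathrm M}$, then $h_\beta$ is non-degenerate. Consequently, for every $\theta_{\mathrm M}$ there is, up to isomorphism, a unique irreducible complex representation $\eta_{\mathrm M}$ of $J^1$ whose restriction to $H^1$ contains $\theta_{\mathrm M}$, and $\dim\eta_{\mathrm M}=q^{N(N-1)/2}$. (iii) If $\mathfrak A=\mathfrak A_{\mathrm m}$, then for every extension $\tilde\theta_{\mathrm m}$ of $\theta_{\mathrm m}$ to a character of $R_\beta$ there is, up to isomorphism, a unique irreducible complex representation $\eta_{\mathrm m}$ of $J^1$ whose restriction to $R_\beta$ contains $\tilde\theta_{\mathrm m}$, and $\dim\eta_{\mathrm m}=\prod_{i=1}^h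 q^{d_im_i(d_i-1)/2}$. -/

import Mathlib

open scoped ValuativeRel

universe u w

noncomputable section

/-! ### Block-upper-triangular (parahoric) algebras and their filtrations

`R` is a commutative ring with an ideal `p`; a map `b : Fin N → Fin e` records the block to which
each of the `N` coordinates belongs. -/

section Parahoric

variable {R : Type*} [CommRing R] (p : Ideal R) {N e : ℕ} (b : Fin N → Fin e)

/-- The algebra `𝔄` of matrices that are block upper-triangular modulo `p`. -/
def parahoric : Subalgebra R (Matrix (Fin N) (Fin N) R) where
  carrier := {x | ∀ i j, b j < b i → x i j ∈ p}
  mul_mem' := by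
    intro x y hx hy i j hij
    rw [Matrix.mul_apply]
    refine Ideal.sum_mem _ fun k _ => ?_
    rcases lt_or_ge (b k) (b i) with h | h
    · exact Ideal.mul_mem_right _ _ (hx i k h)
    · exact Ideal.mul_mem_left _ _ (hy k j (lt_of_lt_of_le hij h))
  add_mem' := fun hx hy i j hij => Ideal.add_mem _ (hx i j hij) (hy i j hij)
  algebraMap_mem' := by
    intro a i j hij
    have hne : i ≠ j := by
      rintro rfl
      exact lt_irrefl _ hij
    rw [Matrix.algebraMap_matrix_apply, if_neg hne]
    exact Ideal.zero_mem _

/-- The radical `𝔓` of `𝔄`, as a module of matrices: those that are strictly block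
upper-triangular modulo `p`. -/
def parahoricRad : Submodule R (Matrix (Fin N) (Fin N) R) where
  carrier := {x | ∀ i j, b j ≤ b i → x i j ∈ p}
  add_mem' := fun hx hy i j hij => Ideal.add_mem _ (hx i j hij) (hy i j hij)
  zero_mem' := fun _ _ _ => Ideal.zero_mem _
  smul_mem' := fun a _ hx i j hij => Ideal.mul_mem_left _ a (hx i j hij)

/-- `𝔓` as an ideal of `𝔄`. -/
def parahoricIdeal : Ideal (parahoric p b) where
  carrier := {x | (x : Matrix (Fin N) (Fin N) R) ∈ parahoricRad p b}
  add_mem' := fun hx hy => (parahoricRad p b).add_mem hx hy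
  zero_mem' := (parahoricRad p b).zero_mem
  smul_mem' := by
    intro x y hy i j hij
    change (x.1 * y.1) i j ∈ p
    rw [Matrix.mul_apply]
    refine Ideal.sum_mem _ fun k _ => ?_
    rcases lt_or_ge (b k) (b i) with h | h
    · exact Ideal.mul_mem_right _ _ (x.2 i k h)
    · exact Ideal.mul_mem_left _ _ (hy k j (le_trans hij h))

instance parahoricIdeal_isTwoSided : (parahoricIdeal p b).IsTwoSided where
  mul_mem_of_left := by
    intro x y hx i j hij
    change (x.1 * y.1) i j ∈ p
    rw [Matrix.mul_apply]
    refine Ideal.sum_mem _ fun k _ => ?_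
    rcases le_or_gt (b k) (b i) with h | h
    · exact Ideal.mul_mem_right _ _ (hx i k h)
    · exact Ideal.mul_mem_left _ _ (y.2 k j (lt_of_le_of_lt hij h))

theorem parahoricRad_mul_self_le :
    parahoricRad p b * parahoricRad p b ≤ parahoricRad p b := by
  rw [Submodule.mul_le]
  intro x hx y hy i j hij
  rw [Matrix.mul_apply]
  refine Ideal.sum_mem _ fun k _ => ?_
  rcases le_or_gt (b k) (b i) with h | h
  · exact Ideal.mul_mem_right _ _ (hx i k h)
  · exact Ideal.mul_mem_left _ _ (hy k j (le_trans hij h.le))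

theorem parahoricRad_pow_mul_self_le (k : ℕ) :
    parahoricRad p b ^ k * parahoricRad p b ^ k ≤ parahoricRad p b ^ k := by
  rw [← (Commute.refl (parahoricRad p b)).mul_pow]
  exact pow_le_pow_left' (parahoricRad_mul_self_le p b) k

/-- The elements of the form `1 + x` with `x ∈ 𝔓 ^ k`, as a submonoid of `GL_N(R)`. -/
def congruenceMonoid (k : ℕ) : Submonoid (GL (Fin N) R) where
  carrier := {g | (g : Matrix (Fin N) (Fin N) R) - 1 ∈ parahoricRad p b ^ k}
  one_mem' := by simp
  mul_mem' := by
    intro g h hg hh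
    have key : ((g * h : GL (Fin N) R) : Matrix (Fin N) (Fin N) R) - 1 =
        ((g : Matrix (Fin N) (Fin N) R) - 1) * ((h : Matrix (Fin N) (Fin N) R) - 1) +
          ((g : Matrix (Fin N) (Fin N) R) - 1) + ((h : Matrix (Fin N) (Fin N) R) - 1) := by
      rw [Units.val_mul]
      noncomm_ring
    change _ ∈ parahoricRad p b ^ k
    rw [key]
    exact Submodule.add_mem _ (Submodule.add_mem _
      (parahoricRad_pow_mul_self_le p b k (Submodule.mul_mem_mul hg hh)) hg) hh

/-- The group `U^k = 1 + 𝔓 ^ k`, for `k ≥ 1`. -/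
def congruenceSubgroup [Finite R] (k : ℕ) : Subgroup (GL (Fin N) R) where
  toSubmonoid := congruenceMonoid p b k
  inv_mem' := by
    intro g hg
    obtain ⟨n, hn⟩ := Submonoid.mem_powers_iff _ _ |>.1
      (mem_powers_iff_mem_zpowers.2 (Subgroup.inv_mem _ (Subgroup.mem_zpowers g)))
    rw [← hn]
    exact Submonoid.pow_mem _ hg n

/-- The centraliser `C` of the matrix `β` in `GL_N(R)`. -/
def matrixCentralizer (β : Matrix (Fin N) (Fin N) R) : Subgroup (GL (Fin N) R) where
  carrier := {g | (g : Matrix (Fin N) (Fin N) R) * β = β * g}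
  one_mem' := by simp
  mul_mem' := by
    intro g h hg hh
    change _ * β = β * _ at hg hh
    change _ * β = β * _
    rw [Units.val_mul, mul_assoc, hh, ← mul_assoc, hg, mul_assoc]
  inv_mem' := by
    intro g hg
    have hg' : (g : Matrix (Fin N) (Fin N) R) * β = β * g := hg
    change _ * β = β * _
    rw [Units.inv_mul_eq_iff_eq_mul, ← mul_assoc, hg', mul_assoc, Units.mul_inv, mul_one]

/-- The group `(C ∩ U^1) U^k`.  (As `U^1` normalises `U^k`, the subgroup generated by the two
factors is their product.) -/
def centralizerMulU [Finite R] (β : Matrix (Fin N) (Fin N) R) (k : ℕ) : Subgroup (GL (Fin N) R) :=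
  (matrixCentralizer β ⊓ congruenceSubgroup p b 1) ⊔ congruenceSubgroup p b k

/-- The group `J^1 = (C ∩ U^1) U^{e l'}`. -/
def groupJ [Finite R] (β : Matrix (Fin N) (Fin N) R) (l' : ℕ) : Subgroup (GL (Fin N) R) :=
  centralizerMulU p b β (e * l')

/-- The group `H^1 = (C ∩ U^1) U^{e l' + 1}`. -/
def groupH [Finite R] (β : Matrix (Fin N) (Fin N) R) (l' : ℕ) : Subgroup (GL (Fin N) R) :=
  centralizerMulU p b β (e * l' + 1)

/-- The additive group `(𝔄 / 𝔓) / C_{𝔄/𝔓}(β + 𝔓)`. -/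
abbrev CentralizerQuotient (β : parahoric p b) : Type _ :=
  (parahoric p b ⧸ parahoricIdeal p b) ⧸
    (Subring.centralizer {Ideal.Quotient.mk (parahoricIdeal p b) β}).toAddSubgroup

end Parahoric

/-- A matrix over `R` is regular if its centraliser in `M_N(R)` is free of rank `N` over `R`. -/
def IsRegularMatrix {R : Type*} [CommRing R] {N : ℕ} (β : Matrix (Fin N) (Fin N) R) : Prop :=
  Module.Free R (Subalgebra.centralizer R {β}) ∧
    Module.finrank R (Subalgebra.centralizer R {β}) = N

/-! ### The rings `𝔬_r = 𝔬 / 𝔭 ^ r` and the functions `ψ_β` -/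

section Truncated

variable (O : Type*) [CommRing O] [IsLocalRing O]

/-- The ring `𝔬_r = 𝔬 / 𝔭 ^ r`. -/
abbrev TruncRing (r : ℕ) : Type _ := O ⧸ IsLocalRing.maximalIdeal O ^ r

instance truncRing_finite [IsNoetherianRing O] [Finite (IsLocalRing.ResidueField O)] (r : ℕ) :
    Finite (TruncRing O r) :=
  haveI : Finite (O ⧸ IsLocalRing.maximalIdeal O) :=
    inferInstanceAs (Finite (IsLocalRing.ResidueField O))
  Ideal.finite_quotient_pow (IsNoetherian.noetherian (IsLocalRing.maximalIdeal O)) r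

/-- The image of `𝔭` in `𝔬_r`. -/
def truncIdeal (r : ℕ) : Ideal (TruncRing O r) :=
  (IsLocalRing.maximalIdeal O).map (Ideal.Quotient.mk (IsLocalRing.maximalIdeal O ^ r))

/-- The reduction map from `𝔬_r` to the residue field, for `r ≥ 1`. -/
def truncReduce {r : ℕ} (hr : r ≠ 0) : TruncRing O r →+* IsLocalRing.ResidueField O :=
  Ideal.Quotient.factor (Ideal.pow_le_self hr)

variable {O}

/-- The value `ψ(ϖ^{-r} a)` for `a ∈ 𝔬_r`, computed on a lift of `a` to `𝔬`; it does not depend on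
the lift when `ψ` is trivial on `𝔬` and `ϖ` is a uniformiser. -/
def psiTrunc {F : Type*} [Field F] [Algebra O F] (ψ : AddChar F ℂ) (ϖ : O) (r : ℕ)
    (a : TruncRing O r) : ℂ :=
  ψ (algebraMap O F (Function.surjInv Ideal.Quotient.mk_surjective a) / algebraMap O F ϖ ^ r)

/-- `ψ_β(1 + x) = ψ(ϖ^{-r} tr(β x))`. -/
def psiBeta {F : Type*} [Field F] [Algebra O F] (ψ : AddChar F ℂ) (ϖ : O) (r : ℕ) {N : ℕ}
    (β : Matrix (Fin N) (Fin N) (TruncRing O r)) (g : GL (Fin N) (TruncRing O r)) : ℂ :=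
  psiTrunc ψ ϖ r (β * ((g : Matrix (Fin N) (Fin N) (TruncRing O r)) - 1)).trace

/-- The character `θ` of `H^1` extends the character `ψ_β` of `U^{e l' + 1}`. -/
def ExtendsPsiBeta [IsNoetherianRing O] [Finite (IsLocalRing.ResidueField O)]
    {F : Type*} [Field F] [Algebra O F] (ψ : AddChar F ℂ) (ϖ : O) (r : ℕ) {N e : ℕ}
    (b : Fin N → Fin e) (β : Matrix (Fin N) (Fin N) (TruncRing O r)) (l' : ℕ)
    (θ : groupH (truncIdeal O r) b β l' →* ℂˣ) : Prop :=
  ∀ g : groupH (truncIdeal O r) b β l',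
    (g : GL (Fin N) (TruncRing O r)) ∈ congruenceSubgroup (truncIdeal O r) b (e * l' + 1) →
      (θ g : ℂ) = psiBeta ψ ϖ r β g

end Truncated

/-! ### Commutator forms and representations lying above a character -/

section Forms

variable {G : Type u} [Group G]

/-- `form` is the bilinear form `(xH, yH) ↦ θ([x, y])` on `J / H`, where `[x, y] = x y x⁻¹ y⁻¹`; in
particular every commutator `[x, y]` with `x, y ∈ J` lies in `H`. -/
def IsCommutatorForm (J H : Subgroup G) [(H.subgroupOf J).Normal] (θ : H →* ℂˣ)
    (form : (J ⧸ H.subgroupOf J) →* ((J ⧸ H.subgroupOf J) →* ℂˣ)) : Prop :=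
  ∀ x y : J, ∃ hxy : (x * y * x⁻¹ * y⁻¹ : G) ∈ H,
    form (x : J ⧸ H.subgroupOf J) (y : J ⧸ H.subgroupOf J) = θ ⟨x * y * x⁻¹ * y⁻¹, hxy⟩

/-- The preimage in `J` (seen as a subgroup of `G`) of the radical
`{x | ∀ y, form x y = 1}` of a form on `J / H`. -/
def formRadical (J H : Subgroup G) [(H.subgroupOf J).Normal]
    (form : (J ⧸ H.subgroupOf J) →* ((J ⧸ H.subgroupOf J) →* ℂˣ)) : Subgroup G :=
  (form.ker.comap (QuotientGroup.mk' (H.subgroupOf J))).map J.subtype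

/-- The character `χ'` of `S'` extends the character `χ` of `S`. -/
def ExtendsCharacter {S S' : Subgroup G} (χ : S →* ℂˣ) (χ' : S' →* ℂˣ) : Prop :=
  S ≤ S' ∧ ∀ (g : G) (hS : g ∈ S) (hS' : g ∈ S'), χ' ⟨g, hS'⟩ = χ ⟨g, hS⟩

/-- `η` is an irreducible representation of `J` whose restriction to the subgroup `S` of `J`
contains the one-dimensional representation `χ`. -/
def IrreducibleAbove (J S : Subgroup G) (χ : S →* ℂˣ) {V : Type*} [AddCommGroup V] [Module ℂ V]
    (η : Representation ℂ J V) : Prop :=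
  η.IsIrreducible ∧
    ∃ v : V, v ≠ 0 ∧ ∀ (g : G) (hJ : g ∈ J) (hS : g ∈ S), η ⟨g, hJ⟩ v = (χ ⟨g, hS⟩ : ℂ) • v

/-- Up to isomorphism there is exactly one irreducible representation of `J` that contains `χ` on
restriction to `S`, and its dimension is `n`. -/
def UniqueIrreducibleAbove (J S : Subgroup G) (χ : S →* ℂˣ) (n : ℕ) : Prop :=
  ∃ (V : Type) (_ : AddCommGroup V) (_ : Module ℂ V) (η : Representation ℂ J V),
    IrreducibleAbove J S χ η ∧ Module.Finite ℂ V ∧ Module.finrank ℂ V = n ∧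
      ∀ (W : Type w) [AddCommGroup W] [Module ℂ W] (η' : Representation ℂ J W),
        IrreducibleAbove J S χ η' → Nonempty (η'.Equiv η)

end Forms

/-! ### The two parahoric algebras attached to a characteristic polynomial -/

section Blocks

/-- The one-block partition of the coordinates, for which `𝔄` is the full matrix algebra. -/
def maxBlock (N : ℕ) : Fin N → Fin 1 := fun _ => 0

theorem mem_parahoric_maxBlock {R : Type*} [CommRing R] (p : Ideal R) {N : ℕ}
    (β : Matrix (Fin N) (Fin N) R) : β ∈ parahoric p (maxBlock N) :=
  fun _ _ hij => absurd hij (lt_irrefl _)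

/-- The `N` coordinates are enumerated lexicographically by triples `(i, j, s)`, where `(i, j)` with
`i < h` and `j < m i` runs through the blocks and `s < d i` is the position inside the block.
`minBlock` sends a coordinate to the number of its block; the blocks are numbered
lexicographically, so that the sequence of block sizes is `d 0` (`m 0` times), `d 1` (`m 1` times),
and so on. -/
def minBlock {N h : ℕ} {m d : Fin h → ℕ}
    (pos : (Σₗ i : Fin h, Fin (m i) ×ₗ Fin (d i)) ≃o Fin N) (x : Fin N) : Fin (∑ i, m i) :=
  finSigmaFinEquiv ⟨(ofLex (pos.symm x)).1, (ofLex (ofLex (pos.symm x)).2).1⟩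

end Blocks

end

/-!
Write `A` and `P` for `𝔄` and `𝔓`, and let `r = 2 l + 1`.

**The filtration.** The powers `P ^ k` are described entrywise in `mem_parahoricRad_pow_iff`.  In
particular `P ^ (e l) = ϖ ^ l A` and `P ^ (e l + 1) = ϖ ^ l P`, so that `J = (C ∩ U^1)(1 + ϖ ^ l A)`
and `H = (C ∩ U^1)(1 + ϖ ^ l P)`.

**The form.** As `ϖ ^ r = 0`, one has `[1 + ϖ ^ l a, 1 + ϖ ^ l d] = 1 + ϖ ^ (2 l) (a d - d a)`
exactly (`val_commutator_eq`).  Together with the fact that `θ` is trivial on the commutators of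
`C ∩ U^1` with `1 + ϖ ^ l A` (`trace_commutator_centralizer_eq_zero`), this shows that `θ` is
invariant under `J`; hence `θ [x, y]` is bimultiplicative on the abelian group `J / H`
(`exists_isCommutatorForm`).  The map `a ↦ 1 + ϖ ^ l a` induces a surjection from `A` to `J / H`,
through which the form becomes `(a, d) ↦ ψ (ϖ ^ (-1) tr ((β a - a β) d))`.  The trace pairing on
`A / P` is perfect, so the radical consists of the `a` that commute with `β` modulo `P`
(`exists_commutatorForm_groupJ`), which gives the index of the radical.

**Regularity.** If the centraliser of `β` is free, its `ϖ`-torsion is its image under `ϖ ^ (2 l)`;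
it is also `ϖ ^ (2 l)` times the lifts of the matrices commuting with the reduction of `β`.  So
these matrices lift to the centraliser of `β` (`IsRegularMatrix.exists_lift_commute`) and there are
`q ^ N` of them.  For `A = M_N` it follows that the form is non-degenerate.  In the other case the
blocks have irreducible characteristic polynomials, and centralisers of order `q ^ (d i)`.

**Representations.** Let `χ` be an invariant character of a normal subgroup `S` of `J` whose
commutator pairing is non-degenerate modulo `S`.  The character of an irreducible representation
above `χ` is `n χ` on `S` and vanishes elsewhere, so orthogonality of characters shows that its
dimension `n` satisfies `n ^ 2 = [J : S]` and that it is unique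
(`uniqueIrreducibleAbove_of_nondegenerate`).  An extension of `θ` to the radical of the form is such
a character.
-/

/-! ### Irreducible representations above a fully ramified character -/

section Heisenberg

open Representation

variable {Γ : Type*} [Group Γ] {T : Subgroup Γ} {χ : T →* ℂˣ}

section Finite

variable {V : Type*} [AddCommGroup V] [Module ℂ V]

/-- The eigenspace of an invariant character of a normal subgroup is a subrepresentation, so it is
everything when the representation is irreducible. -/
theorem Representation.IsIrreducible.apply_eq_smul_of_invariant (hT : T.Normal)
    (hinv : ∀ (g : Γ) (t : T), χ ⟨g * t * g⁻¹, hT.conj_mem t t.2 g⟩ = χ t)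
    (ρ : Representation ℂ Γ V) (hρ : ρ.IsIrreducible) {v : V} (hv : v ≠ 0)
    (h : ∀ t : T, ρ t v = (χ t : ℂ) • v) (t : T) (w : V) : ρ t w = (χ t : ℂ) • w := by
  let E : Subrepresentation ρ :=
    { toSubmodule :=
        { carrier := {w | ∀ t : T, ρ t w = (χ t : ℂ) • w}
          add_mem' := fun {a b} ha hb t => by rw [map_add, ha t, hb t, smul_add]
          zero_mem' := fun t => by simp
          smul_mem' := fun c a ha t => by rw [map_smul, ha t, smul_comm] }
      apply_mem_toSubmodule := by
        intro g w hw t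
        have h1 := hw ⟨g⁻¹ * t * g⁻¹⁻¹, hT.conj_mem t t.2 g⁻¹⟩
        rw [hinv] at h1
        calc ρ t (ρ g w) = ρ g (ρ (g⁻¹ * t * g⁻¹⁻¹) w) := by
              rw [← Module.End.mul_apply, ← Module.End.mul_apply, ← map_mul, ← map_mul]
              congr 2; group
          _ = _ := by rw [h1, map_smul] }
  rcases hρ.eq_bot_or_eq_top E with hE | hE
  · have hvE : v ∈ E := h
    rw [hE] at hvE
    exact absurd ((Submodule.mem_bot ℂ).1 hvE) hv
  · have hwE : w ∈ E := by rw [hE]; exact Submodule.mem_top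
    exact hwE t

/-- The orbit of a nonzero vector spans an irreducible representation. -/
theorem Representation.IsIrreducible.finite [Finite Γ] (ρ : Representation ℂ Γ V)
    (hρ : ρ.IsIrreducible) {v : V} (hv : v ≠ 0) : Module.Finite ℂ V := by
  let E : Subrepresentation ρ :=
    { toSubmodule := Submodule.span ℂ (Set.range fun g => ρ g v)
      apply_mem_toSubmodule := by
        intro g w hw
        have : Submodule.span ℂ (Set.range fun g => ρ g v) ≤
            (Submodule.span ℂ (Set.range fun g => ρ g v)).comap (ρ g) := by
          rw [Submodule.span_le]
          rintro _ ⟨g', rfl⟩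
          refine Submodule.subset_span ⟨g * g', ?_⟩
          simp
        exact this hw }
  have hvE : v ∈ E := Submodule.subset_span ⟨1, by simp⟩
  rcases hρ.eq_bot_or_eq_top E with hE | hE
  · rw [hE] at hvE
    exact absurd ((Submodule.mem_bot ℂ).1 hvE) hv
  · have : Submodule.span ℂ (Set.range fun g => ρ g v) = ⊤ :=
      congrArg Subrepresentation.toSubmodule hE
    exact Module.finite_def.2 (this ▸ Submodule.fg_span (Set.finite_range _))

/-- If `T` acts by `χ`, then `ρ (y x y⁻¹) = χ [y, x] • ρ x`, so the trace of `ρ x` vanishes as soon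
as some `χ [y, x]` differs from `1`. -/
theorem Representation.character_eq_zero_of_commutator (ρ : Representation ℂ Γ V)
    (h : ∀ (t : T) (w : V), ρ t w = (χ t : ℂ) • w) {x y : Γ}
    (hxy : y * x * y⁻¹ * x⁻¹ ∈ T) (hne : χ ⟨_, hxy⟩ ≠ 1) : ρ.character x = 0 := by
  have h1 : ρ (y * x * y⁻¹) = (χ ⟨_, hxy⟩ : ℂ) • ρ x := by
    have h2 : ρ (y * x * y⁻¹) = ρ (y * x * y⁻¹ * x⁻¹) * ρ x := by
      rw [← map_mul]; congr 1; group
    rw [h2]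
    ext w
    exact h ⟨_, hxy⟩ (ρ x w)
  have h2 := ρ.char_conj x y
  rw [Representation.character, Representation.character, h1, map_smul, smul_eq_mul] at h2
  by_contra h0
  exact hne (Units.ext (mul_right_cancel₀ h0 (h2.trans (one_mul _).symm)))

theorem Representation.character_apply_of_forall_apply_eq_smul [Module.Finite ℂ V]
    (ρ : Representation ℂ Γ V)
    (h : ∀ (t : T) (w : V), ρ t w = (χ t : ℂ) • w) (t : T) :
    ρ.character t = (χ t : ℂ) * Module.finrank ℂ V := by
  have h1 : ρ t = (χ t : ℂ) • (1 : V →ₗ[ℂ] V) := by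
    ext w; exact h t w
  rw [Representation.character, h1, map_smul, smul_eq_mul, LinearMap.trace_one]

end Finite

variable {V W : Type*} [AddCommGroup V] [Module ℂ V] [AddCommGroup W] [Module ℂ W]

theorem Representation.sum_character_mul_character_of_vanish [Fintype Γ] [Module.Finite ℂ V]
    [Module.Finite ℂ W]
    (ρ : Representation ℂ Γ V) (σ : Representation ℂ Γ W)
    (hρ : ∀ (t : T) (w : V), ρ t w = (χ t : ℂ) • w)
    (hσ : ∀ (t : T) (w : W), σ t w = (χ t : ℂ) • w)
    (hnd : ∀ x ∉ T, ∃ y, ∃ hxy : y * x * y⁻¹ * x⁻¹ ∈ T, χ ⟨_, hxy⟩ ≠ 1) :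
    ∑ g : Γ, ρ.character g * σ.character g⁻¹ =
      Nat.card T * (Module.finrank ℂ V * Module.finrank ℂ W) := by
  classical
  have h1 : ∀ g : Γ, ρ.character g * σ.character g⁻¹ =
      if g ∈ T then (Module.finrank ℂ V * Module.finrank ℂ W : ℂ) else 0 := by
    intro g
    split_ifs with hg
    · have e1 := ρ.character_apply_of_forall_apply_eq_smul hρ ⟨g, hg⟩
      have e2 := σ.character_apply_of_forall_apply_eq_smul hσ (⟨g, hg⟩⁻¹)
      simp only [InvMemClass.coe_inv] at e2
      rw [e1, e2, map_inv, Units.val_inv_eq_inv_val]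
      field_simp
    · obtain ⟨y, hxy, hne⟩ := hnd g hg
      rw [ρ.character_eq_zero_of_commutator hρ hxy hne, zero_mul]
  rw [Finset.sum_congr rfl fun g _ => h1 g, ← Finset.sum_filter, Finset.sum_const, nsmul_eq_mul,
    Nat.card_eq_fintype_card, Fintype.card_subtype]

/-- The dimension is computed from `⟨ρ, ρ⟩ = 1`, as the character of `ρ` is supported on `T`. -/
theorem Representation.IsIrreducible.sq_finrank_eq_index [Finite Γ] [Module.Finite ℂ V]
    (ρ : Representation ℂ Γ V) (hirr : ρ.IsIrreducible)
    (hρ : ∀ (t : T) (w : V), ρ t w = (χ t : ℂ) • w)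
    (hnd : ∀ x ∉ T, ∃ y, ∃ hxy : y * x * y⁻¹ * x⁻¹ ∈ T, χ ⟨_, hxy⟩ ≠ 1) :
    Module.finrank ℂ V ^ 2 = T.index := by
  have := Fintype.ofFinite Γ
  have h0 : (Nat.card Γ : ℂ) ≠ 0 := Nat.cast_ne_zero.2 Nat.card_pos.ne'
  have := invertibleOfNonzero h0
  have h1 := Representation.char_orthonormal ρ ρ
  rw [sum_character_mul_character_of_vanish ρ ρ hρ hρ hnd, if_pos ⟨.refl ρ⟩,
    inv_mul_eq_iff_eq_mul₀ h0, mul_one] at h1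
  have h2 : Nat.card T * Module.finrank ℂ V ^ 2 = Nat.card T * T.index := by
    rw [T.card_mul_index, sq]
    exact_mod_cast h1
  exact Nat.eq_of_mul_eq_mul_left Nat.card_pos h2

/-- Two irreducible representations above `χ` have characters that are not orthogonal. -/
theorem Representation.IsIrreducible.nonempty_equiv [Finite Γ] [Module.Finite ℂ V]
    [Module.Finite ℂ W] (ρ : Representation ℂ Γ V) (hirr : ρ.IsIrreducible)
    (σ : Representation ℂ Γ W) (hirr' : σ.IsIrreducible)
    (hρ : ∀ (t : T) (w : V), ρ t w = (χ t : ℂ) • w)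
    (hσ : ∀ (t : T) (w : W), σ t w = (χ t : ℂ) • w)
    (hnd : ∀ x ∉ T, ∃ y, ∃ hxy : y * x * y⁻¹ * x⁻¹ ∈ T, χ ⟨_, hxy⟩ ≠ 1) :
    Nonempty (σ.Equiv ρ) := by
  have := Fintype.ofFinite Γ
  have h0 : (Nat.card Γ : ℂ) ≠ 0 := Nat.cast_ne_zero.2 Nat.card_pos.ne'
  have := invertibleOfNonzero h0
  have h1 := Representation.char_orthonormal ρ σ
  rw [sum_character_mul_character_of_vanish ρ σ hρ hσ hnd] at h1
  by_contra hne
  rw [if_neg hne] at h1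
  have i1 : T.index ≠ 0 := Subgroup.index_ne_zero_of_finite
  have hV : Module.finrank ℂ V ≠ 0 := by
    intro h; rw [← hirr.sq_finrank_eq_index ρ hρ hnd, h] at i1; exact i1 rfl
  have hW : Module.finrank ℂ W ≠ 0 := by
    intro h; rw [← hirr'.sq_finrank_eq_index σ hσ hnd, h] at i1; exact i1 rfl
  have hT : Nat.card T ≠ 0 := Nat.card_pos.ne'
  simp [hV, hW, hT] at h1

end Heisenberg

section Existence

variable {Γ : Type*} [Group Γ] {V : Type*} [AddCommGroup V] [Module ℂ V]

/-- A nonzero finite-dimensional representation contains an irreducible one. -/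
theorem Representation.exists_isIrreducible_toRepresentation [Module.Finite ℂ V] [Nontrivial V]
    (ρ : Representation ℂ Γ V) :
    ∃ E : Subrepresentation ρ, E.toRepresentation.IsIrreducible := by
  have hwf : WellFoundedLT (Subrepresentation ρ) :=
    ⟨(InvImage.wf Subrepresentation.toSubmodule
      (wellFounded_lt (α := Submodule ℂ V))).mono fun a b hab => hab⟩
  have hne : (⊤ : Subrepresentation ρ) ≠ ⊥ := by
    intro h
    exact top_ne_bot (congrArg Subrepresentation.toSubmodule h)
  obtain ⟨E, hE, -⟩ :=
    (IsAtomic.eq_bot_or_exists_atom_le (⊤ : Subrepresentation ρ)).resolve_left hne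
  refine ⟨E, ?_⟩
  have hnt : Nontrivial (Subrepresentation E.toRepresentation) := by
    refine ⟨⊥, ⊤, fun h => hE.1 ?_⟩
    have h' : (⊥ : Submodule ℂ E.toSubmodule) = ⊤ := congrArg Subrepresentation.toSubmodule h
    apply Subrepresentation.toSubmodule_injective
    have h2 := congrArg (Submodule.map E.toSubmodule.subtype) h'
    rw [Submodule.map_bot, Submodule.map_top, Submodule.range_subtype] at h2
    exact h2.symm
  refine ⟨fun D => ?_⟩
  let D' : Subrepresentation ρ :=
    { toSubmodule := D.toSubmodule.map E.toSubmodule.subtype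
      apply_mem_toSubmodule := by
        rintro g _ ⟨w, hw, rfl⟩
        exact ⟨_, D.apply_mem_toSubmodule g hw, rfl⟩ }
  have hle : D' ≤ E := by
    rintro _ ⟨w, -, rfl⟩
    exact w.2
  rcases hE.le_iff.1 hle with h | h
  · left
    apply Subrepresentation.toSubmodule_injective
    apply Submodule.map_injective_of_injective E.toSubmodule.injective_subtype
    have h2 := congrArg Subrepresentation.toSubmodule h
    exact h2.trans (Submodule.map_bot _).symm
  · right
    apply Subrepresentation.toSubmodule_injective
    apply Submodule.map_injective_of_injective E.toSubmodule.injective_subtype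
    have h2 := congrArg Subrepresentation.toSubmodule h
    exact h2.trans (by rw [show (⊤ : Subrepresentation E.toRepresentation).toSubmodule = ⊤ from rfl,
      Submodule.map_top, Submodule.range_subtype])

/-- On the representation induced by an invariant character `χ` of a normal subgroup `T`, the
subgroup `T` acts by `χ`, and hence so it does on every irreducible constituent. -/
theorem exists_isIrreducible_apply_eq_smul [Finite Γ] {T : Subgroup Γ} {χ : T →* ℂˣ} (hT : T.Normal)
    (hinv : ∀ (g : Γ) (t : T), χ ⟨g * t * g⁻¹, hT.conj_mem t t.2 g⟩ = χ t) :
    ∃ (V : Type) (_ : AddCommGroup V) (_ : Module ℂ V) (η : Representation ℂ Γ V),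
      Module.Finite ℂ V ∧ η.IsIrreducible ∧ ∀ (t : T) (w : V), η t w = (χ t : ℂ) • w := by
  classical
  let χ' : Representation ℂ T ℂ :=
    (Algebra.lmul ℂ ℂ).toRingHom.toMonoidHom.comp ((Units.coeHom ℂ).comp χ)
  have hχ' : ∀ t z, χ' t z = χ t * z := fun t z => rfl
  let ρ := Representation.coind T.subtype χ'
  have hρ : ∀ (t : T) w, ρ t w = (χ t : ℂ) • w := by
    rintro t ⟨w, hw⟩
    ext x
    have h1 := (Representation.mem_coindV T.subtype χ' w).1 hw ⟨x * t * x⁻¹, hT.conj_mem t t.2 x⟩ x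
    rw [hχ', hinv] at h1
    change w (x * t) = χ t * w x
    rw [← h1]
    congr 1
    simp
  let w₀ : Γ → ℂ := fun g => if hg : g ∈ T then (χ ⟨g, hg⟩ : ℂ) else 0
  have hw₀ : w₀ ∈ Representation.coindV T.subtype χ' := by
    rw [Representation.mem_coindV]
    intro t x
    rw [hχ']
    by_cases hx : x ∈ T
    · have h2 : (t : Γ) * x ∈ T := T.mul_mem t.2 hx
      have h3 : (⟨(t : Γ) * x, h2⟩ : T) = t * ⟨x, hx⟩ := rfl
      simp only [w₀, Subgroup.coe_subtype, dif_pos h2, dif_pos hx, h3, map_mul, Units.val_mul]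
    · have h2 : (t : Γ) * x ∉ T := fun h => hx ((T.mul_mem_cancel_left t.2).1 h)
      simp only [w₀, Subgroup.coe_subtype, dif_neg h2, dif_neg hx, mul_zero]
  have hnt : Nontrivial (Representation.coindV T.subtype χ') := by
    refine ⟨⟨w₀, hw₀⟩, 0, fun h => ?_⟩
    have h2 := congrFun (congrArg Subtype.val h) 1
    simp only [w₀, dif_pos T.one_mem] at h2
    exact (χ ⟨1, T.one_mem⟩).ne_zero h2
  have hfin : Module.Finite ℂ (Representation.coindV T.subtype χ') := inferInstance
  -- Transport to a coordinate space, which lives in the lowest universe.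
  let e := (Module.finBasis ℂ (Representation.coindV T.subtype χ')).equivFun
  let ρ' : Representation ℂ Γ _ := (e.conjAlgEquiv ℂ).toRingEquiv.toMonoidHom.comp ρ
  have hρ' : ∀ (t : T) w, ρ' t w = (χ t : ℂ) • w := by
    intro t w
    change e (ρ t (e.symm w)) = _
    rw [hρ, map_smul, e.apply_symm_apply]
  have hnt' := e.symm.toEquiv.nontrivial
  obtain ⟨E, hE⟩ := ρ'.exists_isIrreducible_toRepresentation
  exact ⟨E.toSubmodule, inferInstance, inferInstance, E.toRepresentation, inferInstance, hE,
    fun t w => Subtype.ext (hρ' t w)⟩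

end Existence

/-- Stone–von Neumann for a finite group `J` with a normal subgroup `S` and a `J`-invariant
character `χ` of `S` for which the commutator pairing is non-degenerate modulo `S`. -/
theorem uniqueIrreducibleAbove_of_nondegenerate {G : Type u} [Group G] {J S : Subgroup G} [Finite J]
    (hSJ : S ≤ J) (χ : S →* ℂˣ)
    (hinv : ∀ x ∈ J, ∀ s : S, ∃ h : x * s * x⁻¹ ∈ S, χ ⟨_, h⟩ = χ s)
    (hnd : ∀ x ∈ J, x ∉ S → ∃ y ∈ J, ∃ h : y * x * y⁻¹ * x⁻¹ ∈ S, χ ⟨_, h⟩ ≠ 1)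
    {n : ℕ} (hn : n ^ 2 = S.relIndex J) : UniqueIrreducibleAbove.{u, w} J S χ n := by
  have hT : (S.subgroupOf J).Normal := ⟨fun s hs g => (hinv g g.2 ⟨s, hs⟩).1⟩
  let χ' : S.subgroupOf J →* ℂˣ := χ.comp (Subgroup.subgroupOfEquivOfLe hSJ).toMonoidHom
  have hχ' : ∀ s : S.subgroupOf J, χ' s = χ ⟨s, s.2⟩ := fun s => rfl
  have hinv' : ∀ (g : J) (t : S.subgroupOf J),
      χ' ⟨g * t * g⁻¹, hT.conj_mem t t.2 g⟩ = χ' t := fun g t => (hinv g g.2 ⟨t, t.2⟩).2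
  have hnd' : ∀ x ∉ S.subgroupOf J, ∃ y, ∃ hxy : y * x * y⁻¹ * x⁻¹ ∈ S.subgroupOf J,
      χ' ⟨_, hxy⟩ ≠ 1 := by
    intro x hx
    obtain ⟨y, hy, h, hne⟩ := hnd x x.2 hx
    exact ⟨⟨y, hy⟩, h, hne⟩
  obtain ⟨V, _, _, η, hfin, hirr, hη⟩ := exists_isIrreducible_apply_eq_smul hT hinv'
  have hdim := hirr.sq_finrank_eq_index η hη hnd'
  have hdim' : Module.finrank ℂ V = n :=
    Nat.pow_left_injective two_ne_zero (hdim.trans hn.symm)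
  have hnt : Nontrivial V := by
    apply Module.nontrivial_of_finrank_pos (R := ℂ)
    have : Module.finrank ℂ V ^ 2 ≠ 0 := hdim.trans_ne Subgroup.index_ne_zero_of_finite
    exact Nat.pos_of_ne_zero fun h => this (by rw [h]; rfl)
  obtain ⟨v, hv⟩ := exists_ne (0 : V)
  refine ⟨V, _, _, η, ⟨hirr, v, hv, fun g hJ hS => hη ⟨⟨g, hJ⟩, hS⟩ v⟩, hfin, hdim', ?_⟩
  rintro W _ _ η' ⟨hirr', v', hv', h'⟩
  have hη' := hirr'.apply_eq_smul_of_invariant hT hinv' η' hv' fun t => h' t t.1.2 t.2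
  have hfin' := hirr'.finite η' hv'
  exact hirr.nonempty_equiv η η' hirr' hη hη' hnd'

/-! ### The commutator form of an invariant character -/

section CommutatorForm

variable {G : Type u} [Group G] {J H : Subgroup G}

/-- When `J / H` is abelian and `θ` is `J`-invariant, `(x, y) ↦ θ [x, y]` is bimultiplicative, by
the identities `[x y, z] = x [y, z] x⁻¹ [x, z]` and `[x, y z] = [x, y] (y [x, z] y⁻¹)`. -/
theorem exists_isCommutatorForm [hN : (H.subgroupOf J).Normal] (θ : H →* ℂˣ)
    (hinv : ∀ x ∈ J, ∀ s : H, ∃ h : x * s * x⁻¹ ∈ H, θ ⟨_, h⟩ = θ s)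
    (hcomm : ∀ x ∈ J, ∀ y ∈ J, x * y * x⁻¹ * y⁻¹ ∈ H) :
    ∃ form : (J ⧸ H.subgroupOf J) →* ((J ⧸ H.subgroupOf J) →* ℂˣ),
      IsCommutatorForm J H θ form := by
  let c : J → J → ℂˣ := fun x y => θ ⟨x * y * (x : G)⁻¹ * (y : G)⁻¹, hcomm x x.2 y y.2⟩
  have hl : ∀ x y z, c (x * y) z = c x z * c y z := by
    intro x y z
    obtain ⟨h, e⟩ := hinv x x.2 ⟨_, hcomm y y.2 z z.2⟩
    change _ = c x z * θ _
    rw [mul_comm, ← e, ← map_mul]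
    refine congrArg θ (Subtype.ext ?_)
    simp
    group
  have hr : ∀ x y z, c x (y * z) = c x y * c x z := by
    intro x y z
    obtain ⟨h, e⟩ := hinv y y.2 ⟨_, hcomm x x.2 z z.2⟩
    change _ = c x y * θ _
    rw [← e, ← map_mul]
    refine congrArg θ (Subtype.ext ?_)
    simp
    group
  -- Invariance of `θ` says that `H` lies in the radical on either side.
  have hHl : ∀ x y : J, (x : G) ∈ H → c x y = 1 := by
    intro x y hx
    obtain ⟨h, e⟩ := hinv y y.2 ⟨x, hx⟩
    have : c x y * θ ⟨_, h⟩ = θ ⟨x, hx⟩ := by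
      rw [← map_mul]
      congr 1
      ext
      simp
      group
    rw [e] at this
    exact mul_eq_right.1 this
  have hHr : ∀ x y : J, (y : G) ∈ H → c x y = 1 := by
    intro x y hy
    obtain ⟨h, e⟩ := hinv x x.2 ⟨y, hy⟩
    have : c x y * θ ⟨y, hy⟩ = θ ⟨_, h⟩ := by
      rw [← map_mul]
      congr 1
      ext
      simp
    rw [e] at this
    exact mul_eq_right.1 this
  let F : J → (J ⧸ H.subgroupOf J) →* ℂˣ := fun x =>
    QuotientGroup.lift _ (MonoidHom.mk' (c x) (hr x)) fun y hy => hHr x y hy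
  have hFmul : ∀ x y, F (x * y) = F x * F y := by
    intro x y
    refine QuotientGroup.monoidHom_ext _ (MonoidHom.ext fun z => ?_)
    exact hl x y z
  refine ⟨QuotientGroup.lift _ (MonoidHom.mk' F hFmul) ?_, fun x y => ⟨hcomm x x.2 y y.2, rfl⟩⟩
  intro x hx
  refine QuotientGroup.monoidHom_ext _ (MonoidHom.ext fun z => ?_)
  exact hHl x z hx

theorem commutator_mem_of_surjective [hN : (H.subgroupOf J).Normal] {A : Type*} [CommGroup A]
    {φ : A →* J ⧸ H.subgroupOf J} (hφ : Function.Surjective φ) {x y : G} (hx : x ∈ J)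
    (hy : y ∈ J) : x * y * x⁻¹ * y⁻¹ ∈ H := by
  let X : J := ⟨x, hx⟩
  let Y : J := ⟨y, hy⟩
  obtain ⟨a, ha⟩ := hφ (X : J ⧸ H.subgroupOf J)
  obtain ⟨d, hd⟩ := hφ (Y : J ⧸ H.subgroupOf J)
  have h : ((X * Y * X⁻¹ * Y⁻¹ : J) : J ⧸ H.subgroupOf J) = 1 := by
    rw [QuotientGroup.mk_mul, QuotientGroup.mk_mul, QuotientGroup.mk_mul, QuotientGroup.mk_inv,
      QuotientGroup.mk_inv, ← ha, ← hd, ← map_mul, mul_comm a d, map_mul, mul_inv_cancel_right,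
      mul_inv_cancel]
  exact (QuotientGroup.eq_one_iff (N := H.subgroupOf J) (X * Y * X⁻¹ * Y⁻¹)).1 h

theorem mem_formRadical_iff [hN : (H.subgroupOf J).Normal]
    {form : (J ⧸ H.subgroupOf J) →* ((J ⧸ H.subgroupOf J) →* ℂˣ)} {x : G} :
    x ∈ formRadical J H form ↔ ∃ hx : x ∈ J, form ((⟨x, hx⟩ : J) : J ⧸ H.subgroupOf J) = 1 := by
  constructor
  · rintro ⟨y, hy, rfl⟩
    exact ⟨y.2, hy⟩
  · rintro ⟨hx, h⟩
    exact ⟨⟨x, hx⟩, h, rfl⟩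

theorem formRadical_le [hN : (H.subgroupOf J).Normal]
    (form : (J ⧸ H.subgroupOf J) →* ((J ⧸ H.subgroupOf J) →* ℂˣ)) : formRadical J H form ≤ J :=
  fun _ hx => (mem_formRadical_iff.1 hx).1

theorem relIndex_formRadical [hN : (H.subgroupOf J).Normal]
    (form : (J ⧸ H.subgroupOf J) →* ((J ⧸ H.subgroupOf J) →* ℂˣ)) :
    (formRadical J H form).relIndex J = form.ker.index := by
  have : (formRadical J H form).subgroupOf J =
      form.ker.comap (QuotientGroup.mk' (H.subgroupOf J)) := by
    ext x
    rw [Subgroup.mem_subgroupOf, mem_formRadical_iff]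
    exact ⟨fun ⟨_, h⟩ => h, fun h => ⟨x.2, h⟩⟩
  rw [Subgroup.relIndex, this,
    Subgroup.index_comap_of_surjective _ (QuotientGroup.mk'_surjective _)]

/-- An extension of `θ` to the radical of its commutator form is again invariant, and the commutator
pairing is non-degenerate modulo the radical. -/
theorem uniqueIrreducibleAbove_of_eq_formRadical [Finite J] [hN : (H.subgroupOf J).Normal]
    {θ : H →* ℂˣ} {form : (J ⧸ H.subgroupOf J) →* ((J ⧸ H.subgroupOf J) →* ℂˣ)}
    (hform : IsCommutatorForm J H θ form) {S : Subgroup G} (hS : S = formRadical J H form)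
    {θ' : S →* ℂˣ} (hθ' : ExtendsCharacter θ θ') {n : ℕ} (hn : n ^ 2 = S.relIndex J) :
    UniqueIrreducibleAbove.{u, w} J S θ' n := by
  subst hS
  have key : ∀ x y : J, ∃ h : (x : G) * y * x⁻¹ * y⁻¹ ∈ formRadical J H form,
      θ' ⟨_, h⟩ = form (x : J ⧸ H.subgroupOf J) (y : J ⧸ H.subgroupOf J) := by
    intro x y
    obtain ⟨h, e⟩ := hform x y
    exact ⟨hθ'.1 h, by rw [e]; exact hθ'.2 _ h _⟩
  have hanti : ∀ x y : J, form (x : J ⧸ H.subgroupOf J) (y : J ⧸ H.subgroupOf J) = 1 →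
      form (y : J ⧸ H.subgroupOf J) (x : J ⧸ H.subgroupOf J) = 1 := by
    intro x y hxy
    obtain ⟨h, e⟩ := key x y
    obtain ⟨h', e'⟩ := key y x
    rw [← e', ← inv_eq_one, ← map_inv, ← hxy, ← e]
    congr 1
    ext
    simp
    group
  refine uniqueIrreducibleAbove_of_nondegenerate (formRadical_le form) θ' ?_ ?_ hn
  · rintro x hx ⟨s, hs⟩
    obtain ⟨hsJ, hs1⟩ := mem_formRadical_iff.1 hs
    obtain ⟨h, e⟩ := key ⟨x, hx⟩ ⟨s, hsJ⟩
    have h1 : x * s * x⁻¹ ∈ formRadical J H form := by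
      have := mul_mem h hs
      simpa using this
    refine ⟨h1, ?_⟩
    have h2 : (⟨x * s * x⁻¹, h1⟩ : formRadical J H form) = ⟨_, h⟩ * ⟨s, hs⟩ := by
      ext; simp
    rw [h2, map_mul, e, hanti _ _ (by rw [hs1]; rfl), one_mul]
  · intro x hx hxR
    by_contra! hcon
    refine hxR (mem_formRadical_iff.2 ⟨hx, ?_⟩)
    refine QuotientGroup.monoidHom_ext _ (MonoidHom.ext fun z => ?_)
    change form _ (z : J ⧸ H.subgroupOf J) = 1
    obtain ⟨h, e⟩ := key z ⟨x, hx⟩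
    exact hanti z ⟨x, hx⟩ (e.symm.trans (hcon z z.2 h))

end CommutatorForm

/-! ### The powers of the radical of a parahoric algebra -/

section Filtration

variable {R : Type*} [CommRing R] {ϖ : R} {N e : ℕ} {b : Fin N → Fin e}

/-- The entry in position `(i, j)` of an element of `𝔓 ^ k` is divisible by `ϖ ^ n` for
`n = ⌈(k + b i - b j) / e⌉`, that is, for all `n` with `e * (n - 1) < k + b i - b j`; the condition
below is this one freed of subtractions. -/
theorem mem_parahoricRad_pow_iff (hb : Function.Surjective b) {k : ℕ} (hk : 1 ≤ k)
    {x : Matrix (Fin N) (Fin N) R} :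
    x ∈ parahoricRad (Ideal.span {ϖ}) b ^ k ↔
      ∀ i j n, e * n + b j < k + e + b i → ϖ ^ n ∣ x i j := by
  induction k, hk using Nat.le_induction generalizing x with
  | base =>
    rw [pow_one]
    constructor
    · intro hx i j n hn
      rcases Nat.lt_or_ge n 1 with h0 | h1
      · simp [Nat.lt_one_iff.1 h0]
      rcases Nat.eq_or_lt_of_le h1 with rfl | h2
      · rw [pow_one]
        exact Ideal.mem_span_singleton.1 (hx i j (Fin.le_def.2 (by omega)))
      · have := Nat.mul_le_mul_left e h2
        have := (b i).2
        omega
    · intro hx i j hij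
      refine Ideal.mem_span_singleton.2 ?_
      have := hx i j 1 (by rw [Fin.le_def] at hij; omega)
      rwa [pow_one] at this
  | succ k hk ih =>
    constructor
    · intro hx
      rw [pow_succ] at hx
      induction hx using Submodule.mul_induction_on' with
      | mem_mul_mem x hx y hy =>
        intro i j n hn
        rw [Matrix.mul_apply]
        refine Finset.dvd_sum fun t _ => ?_
        rcases lt_or_ge (b t) (b j) with h | h
        · refine Dvd.dvd.mul_right (ih.1 hx i t n ?_) _
          rw [Fin.lt_def] at h
          omega
        · rcases n with _ | n
          · simp
          rw [pow_succ]
          refine mul_dvd_mul (ih.1 hx i t n ?_) (Ideal.mem_span_singleton.1 (hy t j h))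
          have := (b t).2
          rw [mul_add] at hn
          omega
      | add x _ y _ h1 h2 => exact fun i j n hn => dvd_add (h1 i j n hn) (h2 i j n hn)
    · intro hx
      rw [Matrix.matrix_eq_sum_single x, pow_succ']
      refine Submodule.sum_mem _ fun i _ => Submodule.sum_mem _ fun j _ => ?_
      have hbi := (b i).2
      have hbj := (b j).2
      by_cases hi : (b i : ℕ) + 1 < e
      · obtain ⟨i', hi'⟩ := hb ⟨b i + 1, hi⟩
        rw [show Matrix.single i j (x i j) = Matrix.single i i' 1 * Matrix.single i' j (x i j) by
          rw [Matrix.single_mul_single_same, one_mul]]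
        refine Submodule.mul_mem_mul ?_ (ih.2 ?_)
        · intro s t hst
          rw [Matrix.single_apply_of_ne]
          · exact Ideal.zero_mem _
          · rintro ⟨rfl, rfl⟩
            rw [hi', Fin.le_def] at hst
            simp at hst
        · intro s t n hn
          by_cases h : i' = s ∧ j = t
          · obtain ⟨rfl, rfl⟩ := h
            rw [Matrix.single_apply_same]
            rw [hi'] at hn
            exact hx i j n (by simp only at hn; omega)
          · rw [Matrix.single_apply_of_ne _ _ _ _ _ h]
            exact dvd_zero _
      · -- Wrapping around from the last block to the first one costs a factor `ϖ`.
        obtain ⟨i', hi'⟩ := hb ⟨0, by omega⟩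
        obtain ⟨d, hd⟩ := hx i j ((k + e + b i - b j) / e) (by
          have := Nat.mul_div_le (k + e + b i - b j) e
          omega)
        obtain ⟨n₀, hn₀⟩ : ∃ n₀, (k + e + b i - b j) / e = n₀ + 1 := by
          refine ⟨(k + e + b i - b j) / e - 1, ?_⟩
          have : 1 ≤ (k + e + b i - b j) / e := by
            rw [Nat.le_div_iff_mul_le (by omega)]
            omega
          omega
        rw [hn₀, pow_succ', mul_assoc] at hd
        rw [show Matrix.single i j (x i j) =
            Matrix.single i i' ϖ * Matrix.single i' j (ϖ ^ n₀ * d) by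
          rw [Matrix.single_mul_single_same, hd]]
        refine Submodule.mul_mem_mul ?_ (ih.2 ?_)
        · intro s t _
          rw [Matrix.single_apply]
          split_ifs
          · exact Ideal.mem_span_singleton_self ϖ
          · exact Ideal.zero_mem _
        · intro s t n hn
          by_cases h : i' = s ∧ j = t
          · obtain ⟨rfl, rfl⟩ := h
            rw [Matrix.single_apply_same]
            refine Dvd.dvd.mul_right (pow_dvd_pow ϖ ?_) _
            have : n + 1 ≤ (k + e + b i - b j) / e := by
              rw [Nat.le_div_iff_mul_le (by omega), Nat.mul_comm, mul_add]
              rw [hi'] at hn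
              simp only at hn
              omega
            omega
          · rw [Matrix.single_apply_of_ne _ _ _ _ _ h]
            exact dvd_zero _

theorem mem_parahoricRad_pow_mul_iff (hb : Function.Surjective b) (he : 0 < e) {l : ℕ} (hl : 0 < l)
    {x : Matrix (Fin N) (Fin N) R} :
    x ∈ parahoricRad (Ideal.span {ϖ}) b ^ (e * l) ↔
      ∃ a ∈ parahoric (Ideal.span {ϖ}) b, x = ϖ ^ l • a := by
  rw [mem_parahoricRad_pow_iff hb (Nat.mul_pos he hl)]
  constructor
  · intro hx
    have hc : ∀ i j, ∃ c, x i j = ϖ ^ l * c ∧ (b j < b i → c ∈ Ideal.span {ϖ}) := by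
      intro i j
      have hbj := (b j).2
      by_cases h : b j < b i
      · obtain ⟨c, hc⟩ := hx i j (l + 1) (by rw [mul_add]; rw [Fin.lt_def] at h; omega)
        exact ⟨ϖ * c, by rw [hc, pow_succ, mul_assoc], fun _ =>
          Ideal.mem_span_singleton.2 (dvd_mul_right _ _)⟩
      · obtain ⟨c, hc⟩ := hx i j l (by omega)
        exact ⟨c, hc, fun h' => absurd h' h⟩
    choose c hc1 hc2 using hc
    exact ⟨Matrix.of c, hc2, by ext i j; exact hc1 i j⟩
  · rintro ⟨a, ha, rfl⟩ i j n hn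
    rw [Matrix.smul_apply, smul_eq_mul]
    rcases Nat.lt_or_ge l n with h | h
    · rcases Nat.eq_or_lt_of_le (Nat.succ_le_of_lt h) with rfl | h2
      · rw [Nat.succ_eq_add_one, pow_succ]
        refine mul_dvd_mul_left _ (Ideal.mem_span_singleton.1 (ha i j (Fin.lt_def.2 ?_)))
        rw [Nat.succ_eq_add_one, mul_add] at hn
        omega
      · have h3 : e * (l + 2) ≤ e * n := Nat.mul_le_mul_left e h2
        have := (b i).2
        rw [mul_add] at h3
        omega
    · exact Dvd.dvd.mul_right (pow_dvd_pow ϖ h) _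

theorem mem_parahoricRad_pow_mul_add_one_iff (hb : Function.Surjective b) {l : ℕ}
    {x : Matrix (Fin N) (Fin N) R} :
    x ∈ parahoricRad (Ideal.span {ϖ}) b ^ (e * l + 1) ↔
      ∃ a ∈ parahoricRad (Ideal.span {ϖ}) b, x = ϖ ^ l • a := by
  rw [mem_parahoricRad_pow_iff hb (Nat.le_add_left _ _)]
  constructor
  · intro hx
    have hc : ∀ i j, ∃ c, x i j = ϖ ^ l * c ∧ (b j ≤ b i → c ∈ Ideal.span {ϖ}) := by
      intro i j
      have hbj := (b j).2
      by_cases h : b j ≤ b i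
      · obtain ⟨c, hc⟩ := hx i j (l + 1) (by rw [mul_add]; rw [Fin.le_def] at h; omega)
        exact ⟨ϖ * c, by rw [hc, pow_succ, mul_assoc], fun _ =>
          Ideal.mem_span_singleton.2 (dvd_mul_right _ _)⟩
      · obtain ⟨c, hc⟩ := hx i j l (by omega)
        exact ⟨c, hc, fun h' => absurd h' h⟩
    choose c hc1 hc2 using hc
    exact ⟨Matrix.of c, hc2, by ext i j; exact hc1 i j⟩
  · rintro ⟨a, ha, rfl⟩ i j n hn
    rw [Matrix.smul_apply, smul_eq_mul]
    rcases Nat.lt_or_ge l n with h | h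
    · rcases Nat.eq_or_lt_of_le (Nat.succ_le_of_lt h) with rfl | h2
      · rw [Nat.succ_eq_add_one, pow_succ]
        refine mul_dvd_mul_left _ (Ideal.mem_span_singleton.1 (ha i j (Fin.le_def.2 ?_)))
        rw [Nat.succ_eq_add_one, mul_add] at hn
        omega
      · have h3 : e * (l + 2) ≤ e * n := Nat.mul_le_mul_left e h2
        have := (b i).2
        rw [mul_add] at h3
        omega
    · exact Dvd.dvd.mul_right (pow_dvd_pow ϖ h) _

end Filtration

/-! ### The groups `J` and `H` -/

section Groups

variable {R : Type u} [CommRing R] {p : Ideal R} {ϖ : R} {N e l : ℕ} {b : Fin N → Fin e}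
  {β : Matrix (Fin N) (Fin N) R}

theorem parahoricRad_le_parahoric {x : Matrix (Fin N) (Fin N) R} (hx : x ∈ parahoricRad p b) :
    x ∈ parahoric p b :=
  fun i j hij => hx i j hij.le

theorem mul_mem_parahoricRad_left {x y : Matrix (Fin N) (Fin N) R} (hx : x ∈ parahoric p b)
    (hy : y ∈ parahoricRad p b) : x * y ∈ parahoricRad p b :=
  (parahoricIdeal p b).mul_mem_left ⟨x, hx⟩
    (show (⟨y, parahoricRad_le_parahoric hy⟩ : parahoric p b) ∈ parahoricIdeal p b from hy)

theorem mul_mem_parahoricRad_right {x y : Matrix (Fin N) (Fin N) R} (hx : x ∈ parahoricRad p b)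
    (hy : y ∈ parahoric p b) : x * y ∈ parahoricRad p b :=
  Ideal.mul_mem_right (⟨y, hy⟩ : parahoric p b) (parahoricIdeal p b)
    (show (⟨x, parahoricRad_le_parahoric hx⟩ : parahoric p b) ∈ parahoricIdeal p b from hx)

theorem trace_mem_of_mem_parahoricRad {x : Matrix (Fin N) (Fin N) R} (hx : x ∈ parahoricRad p b) :
    x.trace ∈ p :=
  Ideal.sum_mem _ fun i _ => hx i i le_rfl

theorem units_conj_one_add (g : GL (Fin N) R) (a : Matrix (Fin N) (Fin N) R) (c : R) :
    (g : Matrix (Fin N) (Fin N) R) * (1 + c • a) * (g⁻¹ : GL (Fin N) R) =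
      1 + c • ((g : Matrix (Fin N) (Fin N) R) * a * (g⁻¹ : GL (Fin N) R)) := by
  rw [mul_add, add_mul, mul_one, Units.mul_inv, Matrix.mul_smul, Matrix.smul_mul]

/-- As `ϖ ^ (2 l + 1) = 0`, commutators of elements of `1 + ϖ ^ l 𝔄` are given by an exact
formula. -/
theorem val_commutator_eq (hl : 0 < l) (hϖ : ϖ ^ (2 * l + 1) = 0) {g h : GL (Fin N) R}
    {a c : Matrix (Fin N) (Fin N) R} (hg : (g : Matrix (Fin N) (Fin N) R) = 1 + ϖ ^ l • a)
    (hh : (h : Matrix (Fin N) (Fin N) R) = 1 + ϖ ^ l • c) :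
    ((g * h * g⁻¹ * h⁻¹ : GL (Fin N) R) : Matrix (Fin N) (Fin N) R) =
      1 + ϖ ^ (2 * l) • (a * c - c * a) := by
  have h0 : ϖ ^ (2 * l) * ϖ ^ l = 0 := by
    rw [← pow_add]
    exact pow_eq_zero_of_le (by omega) hϖ
  have h1 : ((g * h : GL (Fin N) R) : Matrix (Fin N) (Fin N) R) =
      (1 + ϖ ^ (2 * l) • (a * c - c * a)) * ((h * g : GL (Fin N) R) : Matrix _ _ R) := by
    rw [Units.val_mul, Units.val_mul, hg, hh]
    have h2 : ϖ ^ (2 * l) • (a * c - c * a) * ((1 + ϖ ^ l • c) * (1 + ϖ ^ l • a)) =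
        ϖ ^ (2 * l) • (a * c - c * a) := by
      have h3 : (1 + ϖ ^ l • c) * (1 + ϖ ^ l • a) = 1 + ϖ ^ l • (c + a + ϖ ^ l • (c * a)) := by
        simp only [mul_add, add_mul, mul_one, one_mul, Matrix.smul_mul, Matrix.mul_smul, smul_add]
        abel
      rw [h3, mul_add, mul_one, Matrix.smul_mul, Matrix.mul_smul, smul_smul, h0, zero_smul,
        add_zero]
    rw [add_mul _ _ ((1 + ϖ ^ l • c) * (1 + ϖ ^ l • a)), one_mul, h2, two_mul, pow_add]
    simp only [mul_add, add_mul, mul_one, one_mul, Matrix.smul_mul, Matrix.mul_smul, smul_sub,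
      smul_smul]
    abel
  have h4 : g * h * g⁻¹ * h⁻¹ = g * h * (h * g)⁻¹ := by group
  rw [h4, Units.val_mul, h1, mul_assoc, Units.mul_inv, mul_one]

/-- The unit `1 + ϖ ^ l a`; here `ϖ` is nilpotent. -/
noncomputable def unitOneAdd (hl : 0 < l) (hϖ : ϖ ^ (2 * l + 1) = 0)
    (a : Matrix (Fin N) (Fin N) R) : GL (Fin N) R :=
  (IsNilpotent.isUnit_one_add (r := ϖ ^ l • a) ⟨2 * l + 1, by
    rw [smul_pow, ← pow_mul, mul_comm, pow_mul, hϖ, zero_pow hl.ne', zero_smul]⟩).unit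

theorem val_unitOneAdd (hl : 0 < l) (hϖ : ϖ ^ (2 * l + 1) = 0) (a : Matrix (Fin N) (Fin N) R) :
    (unitOneAdd hl hϖ a : Matrix (Fin N) (Fin N) R) = 1 + ϖ ^ l • a := rfl

/-- `[c, y] = 1 + t z y⁻¹` with `z = c a c⁻¹ - a`, for `y = 1 + t a`. -/
theorem val_commutator_centralizer_eq {c y : GL (Fin N) R} {a : Matrix (Fin N) (Fin N) R} {t : R}
    (hy : (y : Matrix (Fin N) (Fin N) R) = 1 + t • a) :
    ((c * y * c⁻¹ * y⁻¹ : GL (Fin N) R) : Matrix (Fin N) (Fin N) R) =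
      1 + t • (((c : Matrix (Fin N) (Fin N) R) * a * (c⁻¹ : GL (Fin N) R) - a) *
        (y⁻¹ : GL (Fin N) R)) := by
  have h1 : ((c * y * c⁻¹ : GL (Fin N) R) : Matrix (Fin N) (Fin N) R) =
      y + t • ((c : Matrix (Fin N) (Fin N) R) * a * (c⁻¹ : GL (Fin N) R) - a) := by
    rw [Units.val_mul, Units.val_mul, hy, units_conj_one_add, smul_sub]
    abel
  rw [Units.val_mul, h1, add_mul, Units.mul_inv, Matrix.smul_mul]

variable [Finite R]

theorem mem_parahoric_of_mem_congruenceSubgroup_one {g : GL (Fin N) R}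
    (hg : g ∈ congruenceSubgroup p b 1) : (g : Matrix (Fin N) (Fin N) R) ∈ parahoric p b := by
  have h1 : (g : Matrix (Fin N) (Fin N) R) - 1 ∈ parahoricRad p b ^ 1 := hg
  rw [pow_one] at h1
  simpa using add_mem (parahoricRad_le_parahoric h1) (one_mem (parahoric p b))

theorem inv_mem_parahoric_of_mem_congruenceSubgroup_one {g : GL (Fin N) R}
    (hg : g ∈ congruenceSubgroup p b 1) :
    ((g⁻¹ : GL (Fin N) R) : Matrix (Fin N) (Fin N) R) ∈ parahoric p b :=
  mem_parahoric_of_mem_congruenceSubgroup_one (inv_mem hg)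

theorem mem_congruenceSubgroup_mul_iff (hb : Function.Surjective b) (he : 0 < e) (hl : 0 < l)
    {g : GL (Fin N) R} :
    g ∈ congruenceSubgroup (Ideal.span {ϖ}) b (e * l) ↔
      ∃ a ∈ parahoric (Ideal.span {ϖ}) b, (g : Matrix (Fin N) (Fin N) R) = 1 + ϖ ^ l • a := by
  refine (mem_parahoricRad_pow_mul_iff hb he hl).trans ?_
  simp only [sub_eq_iff_eq_add']

theorem mem_congruenceSubgroup_mul_add_one_iff (hb : Function.Surjective b) {g : GL (Fin N) R} :
    g ∈ congruenceSubgroup (Ideal.span {ϖ}) b (e * l + 1) ↔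
      ∃ a ∈ parahoricRad (Ideal.span {ϖ}) b,
        (g : Matrix (Fin N) (Fin N) R) = 1 + ϖ ^ l • a := by
  refine (mem_parahoricRad_pow_mul_add_one_iff hb).trans ?_
  simp only [sub_eq_iff_eq_add']

theorem congruenceSubgroup_mul_add_one_le (hb : Function.Surjective b) (he : 0 < e) (hl : 0 < l) :
    congruenceSubgroup (Ideal.span {ϖ}) b (e * l + 1) ≤
      congruenceSubgroup (Ideal.span {ϖ}) b (e * l) := by
  intro g hg
  obtain ⟨a, ha, h⟩ := (mem_congruenceSubgroup_mul_add_one_iff hb).1 hg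
  exact (mem_congruenceSubgroup_mul_iff hb he hl).2 ⟨a, parahoricRad_le_parahoric ha, h⟩

theorem congruenceSubgroup_mul_le_one (hb : Function.Surjective b) (he : 0 < e) (hl : 0 < l) :
    congruenceSubgroup (Ideal.span {ϖ}) b (e * l) ≤ congruenceSubgroup (Ideal.span {ϖ}) b 1 := by
  intro g hg
  obtain ⟨a, ha, h⟩ := (mem_congruenceSubgroup_mul_iff hb he hl).1 hg
  change (g : Matrix (Fin N) (Fin N) R) - 1 ∈ parahoricRad (Ideal.span {ϖ}) b ^ 1
  rw [pow_one, h, add_sub_cancel_left]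
  intro i j _
  exact Ideal.mul_mem_right _ _ (Ideal.pow_mem_of_mem _ (Ideal.mem_span_singleton_self ϖ) _ hl)

theorem conj_mem_congruenceSubgroup_mul (hb : Function.Surjective b) (he : 0 < e) (hl : 0 < l)
    {g u : GL (Fin N) R} (hg : g ∈ congruenceSubgroup (Ideal.span {ϖ}) b 1)
    (hu : u ∈ congruenceSubgroup (Ideal.span {ϖ}) b (e * l)) :
    g * u * g⁻¹ ∈ congruenceSubgroup (Ideal.span {ϖ}) b (e * l) := by
  obtain ⟨a, ha, h⟩ := (mem_congruenceSubgroup_mul_iff hb he hl).1 hu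
  refine (mem_congruenceSubgroup_mul_iff hb he hl).2
    ⟨_, mul_mem (mul_mem (mem_parahoric_of_mem_congruenceSubgroup_one hg) ha)
      (inv_mem_parahoric_of_mem_congruenceSubgroup_one hg), ?_⟩
  rw [Units.val_mul, Units.val_mul, h, units_conj_one_add]

theorem conj_mem_congruenceSubgroup_mul_add_one (hb : Function.Surjective b)
    {g u : GL (Fin N) R} (hg : g ∈ congruenceSubgroup (Ideal.span {ϖ}) b 1)
    (hu : u ∈ congruenceSubgroup (Ideal.span {ϖ}) b (e * l + 1)) :
    g * u * g⁻¹ ∈ congruenceSubgroup (Ideal.span {ϖ}) b (e * l + 1) := by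
  obtain ⟨a, ha, h⟩ := (mem_congruenceSubgroup_mul_add_one_iff hb).1 hu
  refine (mem_congruenceSubgroup_mul_add_one_iff hb).2
    ⟨_, mul_mem_parahoricRad_right
      (mul_mem_parahoricRad_left (mem_parahoric_of_mem_congruenceSubgroup_one hg) ha)
      (inv_mem_parahoric_of_mem_congruenceSubgroup_one hg), ?_⟩
  rw [Units.val_mul, Units.val_mul, h, units_conj_one_add]

theorem exists_mul_of_mem_groupJ (hb : Function.Surjective b) (he : 0 < e) (hl : 0 < l)
    {g : GL (Fin N) R} (hg : g ∈ groupJ (Ideal.span {ϖ}) b β l) :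
    ∃ c ∈ matrixCentralizer β ⊓ congruenceSubgroup (Ideal.span {ϖ}) b 1,
      ∃ u ∈ congruenceSubgroup (Ideal.span {ϖ}) b (e * l), c * u = g := by
  have hle : matrixCentralizer β ⊓ congruenceSubgroup (Ideal.span {ϖ}) b 1 ≤
      Subgroup.normalizer (congruenceSubgroup (Ideal.span {ϖ}) b (e * l)) := by
    intro c hc
    rw [Subgroup.mem_normalizer_iff]
    refine fun u => ⟨conj_mem_congruenceSubgroup_mul hb he hl hc.2, fun h => ?_⟩
    simpa [mul_assoc] using conj_mem_congruenceSubgroup_mul hb he hl (inv_mem hc.2) h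
  have h1 : g ∈ ((matrixCentralizer β ⊓ congruenceSubgroup (Ideal.span {ϖ}) b 1 ⊔
      congruenceSubgroup (Ideal.span {ϖ}) b (e * l) : Subgroup _) : Set (GL (Fin N) R)) := hg
  rw [Subgroup.coe_mul_of_left_le_normalizer_right _ _ hle] at h1
  exact Set.mem_mul.1 h1

theorem exists_mul_of_mem_groupH (hb : Function.Surjective b)
    {g : GL (Fin N) R} (hg : g ∈ groupH (Ideal.span {ϖ}) b β l) :
    ∃ c ∈ matrixCentralizer β ⊓ congruenceSubgroup (Ideal.span {ϖ}) b 1,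
      ∃ u ∈ congruenceSubgroup (Ideal.span {ϖ}) b (e * l + 1), c * u = g := by
  have hle : matrixCentralizer β ⊓ congruenceSubgroup (Ideal.span {ϖ}) b 1 ≤
      Subgroup.normalizer (congruenceSubgroup (Ideal.span {ϖ}) b (e * l + 1)) := by
    intro c hc
    rw [Subgroup.mem_normalizer_iff]
    refine fun u => ⟨conj_mem_congruenceSubgroup_mul_add_one hb hc.2, fun h => ?_⟩
    simpa [mul_assoc] using conj_mem_congruenceSubgroup_mul_add_one hb (inv_mem hc.2) h
  have h1 : g ∈ ((matrixCentralizer β ⊓ congruenceSubgroup (Ideal.span {ϖ}) b 1 ⊔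
      congruenceSubgroup (Ideal.span {ϖ}) b (e * l + 1) : Subgroup _) : Set (GL (Fin N) R)) := hg
  rw [Subgroup.coe_mul_of_left_le_normalizer_right _ _ hle] at h1
  exact Set.mem_mul.1 h1

theorem groupH_le_groupJ (hb : Function.Surjective b) (he : 0 < e) (hl : 0 < l) :
    groupH (Ideal.span {ϖ}) b β l ≤ groupJ (Ideal.span {ϖ}) b β l :=
  sup_le_sup_left (congruenceSubgroup_mul_add_one_le hb he hl) _

theorem unitOneAdd_mem (hb : Function.Surjective b) (he : 0 < e) (hl : 0 < l)
    (hϖ : ϖ ^ (2 * l + 1) = 0) {a : Matrix (Fin N) (Fin N) R}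
    (ha : a ∈ parahoric (Ideal.span {ϖ}) b) :
    unitOneAdd hl hϖ a ∈ congruenceSubgroup (Ideal.span {ϖ}) b (e * l) :=
  (mem_congruenceSubgroup_mul_iff hb he hl).2 ⟨a, ha, rfl⟩

theorem conj_sub_mem_parahoricRad {c : GL (Fin N) R} (hc : c ∈ congruenceSubgroup p b 1)
    {a : Matrix (Fin N) (Fin N) R} (ha : a ∈ parahoric p b) :
    (c : Matrix (Fin N) (Fin N) R) * a * (c⁻¹ : GL (Fin N) R) - a ∈ parahoricRad p b := by
  have h1 : (c : Matrix (Fin N) (Fin N) R) - 1 ∈ parahoricRad p b ^ 1 := hc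
  rw [pow_one] at h1
  have h2 : (c : Matrix (Fin N) (Fin N) R) * a * (c⁻¹ : GL (Fin N) R) - a =
      (((c : Matrix (Fin N) (Fin N) R) - 1) * a - a * ((c : Matrix (Fin N) (Fin N) R) - 1)) *
        (c⁻¹ : GL (Fin N) R) := by
    simp only [sub_mul, mul_sub, one_mul, mul_one, mul_assoc, Units.mul_inv]
    abel
  rw [h2]
  exact mul_mem_parahoricRad_right (sub_mem (mul_mem_parahoricRad_right h1 ha)
    (mul_mem_parahoricRad_left ha h1)) (inv_mem_parahoric_of_mem_congruenceSubgroup_one hc)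

theorem commutator_mem_of_mem_centralizer (hb : Function.Surjective b) (he : 0 < e) (hl : 0 < l)
    {c y : GL (Fin N) R} (hc : c ∈ congruenceSubgroup (Ideal.span {ϖ}) b 1)
    (hy : y ∈ congruenceSubgroup (Ideal.span {ϖ}) b (e * l)) :
    c * y * c⁻¹ * y⁻¹ ∈ congruenceSubgroup (Ideal.span {ϖ}) b (e * l + 1) := by
  obtain ⟨a, ha, h⟩ := (mem_congruenceSubgroup_mul_iff hb he hl).1 hy
  exact (mem_congruenceSubgroup_mul_add_one_iff hb).2 ⟨_, mul_mem_parahoricRad_right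
    (conj_sub_mem_parahoricRad hc ha) (inv_mem_parahoric_of_mem_congruenceSubgroup_one
      (congruenceSubgroup_mul_le_one hb he hl hy)), val_commutator_centralizer_eq h⟩

theorem centralizer_le_groupH {c : GL (Fin N) R}
    (hc : c ∈ matrixCentralizer β ⊓ congruenceSubgroup p b 1) : c ∈ groupH p b β l :=
  Subgroup.mem_sup_left hc

theorem congruenceSubgroup_le_groupH {u : GL (Fin N) R}
    (hu : u ∈ congruenceSubgroup p b (e * l + 1)) : u ∈ groupH p b β l :=
  Subgroup.mem_sup_right hu

/-- As `J = (C ∩ U^1) U^{e l}`, it suffices that `U^{e l}` normalises `H`; for this,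
`y c y⁻¹ = [c, y]⁻¹ c` with `[c, y] ∈ U^{e l + 1}` for `c ∈ C ∩ U^1`. -/
theorem conj_mem_groupH (hb : Function.Surjective b) (he : 0 < e) (hl : 0 < l)
    {x s : GL (Fin N) R} (hx : x ∈ groupJ (Ideal.span {ϖ}) b β l)
    (hs : s ∈ groupH (Ideal.span {ϖ}) b β l) : x * s * x⁻¹ ∈ groupH (Ideal.span {ϖ}) b β l := by
  have key : ∀ y ∈ congruenceSubgroup (Ideal.span {ϖ}) b (e * l),
      y * s * y⁻¹ ∈ groupH (Ideal.span {ϖ}) b β l := by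
    intro y hy
    obtain ⟨c, hc, u, hu, rfl⟩ := exists_mul_of_mem_groupH hb hs
    have h1 : y * (c * u) * y⁻¹ = (c * y * c⁻¹ * y⁻¹)⁻¹ * c * (y * u * y⁻¹) := by group
    rw [h1]
    exact mul_mem (mul_mem (inv_mem (congruenceSubgroup_le_groupH
      (commutator_mem_of_mem_centralizer hb he hl hc.2 hy))) (centralizer_le_groupH hc))
      (congruenceSubgroup_le_groupH (conj_mem_congruenceSubgroup_mul_add_one hb
        (congruenceSubgroup_mul_le_one hb he hl hy) hu))
  obtain ⟨c, hc, y, hy, rfl⟩ := exists_mul_of_mem_groupJ hb he hl hx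
  have h1 : c * y * s * (c * y)⁻¹ = c * (y * s * y⁻¹) * c⁻¹ := by group
  rw [h1]
  exact mul_mem (mul_mem (centralizer_le_groupH hc) (key y hy)) (inv_mem (centralizer_le_groupH hc))

end Groups

/-! ### The commutator form on `J / H` -/

section FormOnJ

variable {R : Type u} [CommRing R] {ϖ : R} {N e l : ℕ} {b : Fin N → Fin e}
  {β : Matrix (Fin N) (Fin N) R}

theorem pow_mul_trace_eq_zero (hϖ : ϖ ^ (2 * l + 1) = 0) {x : Matrix (Fin N) (Fin N) R}
    (hx : x ∈ parahoricRad (Ideal.span {ϖ}) b) : ϖ ^ (2 * l) * x.trace = 0 := by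
  obtain ⟨t, ht⟩ := Ideal.mem_span_singleton.1 (trace_mem_of_mem_parahoricRad hx)
  rw [ht, ← mul_assoc, ← pow_succ, hϖ, zero_mul]

theorem trace_mul_commutator (x y z : Matrix (Fin N) (Fin N) R) :
    (x * (y * z - z * y)).trace = ((x * y - y * x) * z).trace := by
  rw [mul_sub, sub_mul, Matrix.trace_sub, Matrix.trace_sub, ← mul_assoc, ← mul_assoc,
    Matrix.trace_mul_cycle x z y]

/-- The pairing `(x, y) ↦ Λ (ϖ ^ (2 l) tr (x y))` induces a perfect duality of `𝔄 / 𝔓` with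
itself. -/
theorem mem_parahoricRad_iff_forall_addChar (hϖ : ϖ ^ (2 * l + 1) = 0) {Λ : AddChar R ℂ}
    (hΛ : ∀ a, (∀ y, Λ (ϖ ^ (2 * l) * (a * y)) = 1) → ϖ ∣ a) {x : Matrix (Fin N) (Fin N) R} :
    x ∈ parahoricRad (Ideal.span {ϖ}) b ↔
      ∀ d ∈ parahoric (Ideal.span {ϖ}) b, Λ (ϖ ^ (2 * l) * (x * d).trace) = 1 := by
  constructor
  · intro h d hd
    rw [pow_mul_trace_eq_zero hϖ (mul_mem_parahoricRad_right h hd), AddChar.map_zero_eq_one]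
  · intro h i j hij
    refine Ideal.mem_span_singleton.2 (hΛ _ fun y => ?_)
    have h1 := h (Matrix.single j i y) ?_
    · rw [Matrix.trace_mul_single] at h1
      exact h1
    · intro s t hst
      rw [Matrix.single_apply_of_ne]
      · exact Ideal.zero_mem _
      · rintro ⟨rfl, rfl⟩
        exact absurd hst (not_lt.2 hij)

variable [Finite R]

/-- The character `Λ (tr (β x))` is trivial on the commutators of `C ∩ U^1` with `U^{e l}`: up to
terms killed by `ϖ ^ (2 l + 1) = 0`, these are `1 + ϖ ^ l (c a c⁻¹ - a)`, and `c` commutes with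
`β`. -/
theorem trace_commutator_centralizer_eq_zero (hb : Function.Surjective b) (he : 0 < e)
    (hl : 0 < l) (hϖ : ϖ ^ (2 * l + 1) = 0) (hβ : β ∈ parahoric (Ideal.span {ϖ}) b)
    {c y : GL (Fin N) R} (hc : c ∈ matrixCentralizer β ⊓ congruenceSubgroup (Ideal.span {ϖ}) b 1)
    (hy : y ∈ congruenceSubgroup (Ideal.span {ϖ}) b (e * l)) :
    (β * (((c * y * c⁻¹ * y⁻¹ : GL (Fin N) R) : Matrix (Fin N) (Fin N) R) - 1)).trace = 0 := by
  obtain ⟨a, ha, h⟩ := (mem_congruenceSubgroup_mul_iff hb he hl).1 hy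
  have hcβ : (c : Matrix (Fin N) (Fin N) R) * β = β * c := hc.1
  have hyinv : ((y⁻¹ : GL (Fin N) R) : Matrix (Fin N) (Fin N) R) =
      1 - ϖ ^ l • (a * (y⁻¹ : GL (Fin N) R)) := by
    have h1 : (y : Matrix (Fin N) (Fin N) R) * (y⁻¹ : GL (Fin N) R) = 1 := Units.mul_inv y
    rw [h, add_mul, one_mul, Matrix.smul_mul] at h1
    exact eq_sub_of_add_eq h1
  have hz := conj_sub_mem_parahoricRad hc.2 ha
  have htr : (β * ((c : Matrix (Fin N) (Fin N) R) * a * (c⁻¹ : GL (Fin N) R) - a)).trace = 0 := by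
    rw [mul_sub, Matrix.trace_sub, ← mul_assoc, ← mul_assoc, ← hcβ, mul_assoc _ β a,
      Matrix.trace_mul_cycle, Units.inv_mul, one_mul, sub_self]
  rw [val_commutator_centralizer_eq h, add_sub_cancel_left]
  set z := (c : Matrix (Fin N) (Fin N) R) * a * (c⁻¹ : GL (Fin N) R) - a
  rw [hyinv, mul_sub z, mul_one, Matrix.mul_smul, Matrix.mul_smul, mul_sub β, Matrix.mul_smul,
    Matrix.trace_smul, Matrix.trace_sub, htr, zero_sub, Matrix.trace_smul, smul_neg, smul_smul,
    ← pow_add, ← two_mul, smul_eq_mul, pow_mul_trace_eq_zero (b := b) hϖ, neg_zero]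
  exact mul_mem_parahoricRad_left hβ (mul_mem_parahoricRad_right hz (mul_mem ha
    (inv_mem_parahoric_of_mem_congruenceSubgroup_one (congruenceSubgroup_mul_le_one hb he hl hy))))

/-- Any character of `H` extending `Λ (tr (β x))` is invariant under conjugation by `J`. -/
theorem apply_conj_eq_of_extends (hb : Function.Surjective b) (he : 0 < e)
    (hl : 0 < l) (hϖ : ϖ ^ (2 * l + 1) = 0) (hβ : β ∈ parahoric (Ideal.span {ϖ}) b)
    {Λ : AddChar R ℂ} {θ : groupH (Ideal.span {ϖ}) b β l →* ℂˣ}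
    (hθ : ∀ g : groupH (Ideal.span {ϖ}) b β l,
      (g : GL (Fin N) R) ∈ congruenceSubgroup (Ideal.span {ϖ}) b (e * l + 1) →
        (θ g : ℂ) = Λ (β * ((g : GL (Fin N) R) - 1 : Matrix (Fin N) (Fin N) R)).trace)
    {x : GL (Fin N) R} (hx : x ∈ groupJ (Ideal.span {ϖ}) b β l)
    (s : groupH (Ideal.span {ϖ}) b β l) :
    θ ⟨x * s * x⁻¹, conj_mem_groupH hb he hl hx s.2⟩ = θ s := by
  have key : ∀ y ∈ congruenceSubgroup (Ideal.span {ϖ}) b (e * l),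
      ∀ (s : GL (Fin N) R) (hs : s ∈ groupH (Ideal.span {ϖ}) b β l)
        (hm : y * s * y⁻¹ ∈ groupH (Ideal.span {ϖ}) b β l), θ ⟨_, hm⟩ = θ ⟨s, hs⟩ := by
    intro y hy s hs hm
    obtain ⟨c, hc, u, hu, rfl⟩ := exists_mul_of_mem_groupH hb hs
    have m1 := commutator_mem_of_mem_centralizer hb he hl hc.2 hy
    have e1 : θ ⟨_, congruenceSubgroup_le_groupH m1⟩ = 1 := by
      refine Units.ext ((hθ _ m1).trans ?_)
      rw [trace_commutator_centralizer_eq_zero hb he hl hϖ hβ hc hy, AddChar.map_zero_eq_one,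
        Units.val_one]
    have m2 : y * u * y⁻¹ * u⁻¹ ∈ congruenceSubgroup (Ideal.span {ϖ}) b (e * l + 1) :=
      mul_mem (conj_mem_congruenceSubgroup_mul_add_one hb
        (congruenceSubgroup_mul_le_one hb he hl hy) hu) (inv_mem hu)
    have e2 : θ ⟨_, congruenceSubgroup_le_groupH m2⟩ = 1 := by
      obtain ⟨a, ha, h⟩ := (mem_congruenceSubgroup_mul_iff hb he hl).1 hy
      obtain ⟨d, hd, h'⟩ := (mem_congruenceSubgroup_mul_add_one_iff hb).1 hu
      refine Units.ext ((hθ _ m2).trans ?_)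
      rw [val_commutator_eq hl hϖ h h', add_sub_cancel_left, Matrix.mul_smul, Matrix.trace_smul,
        trace_mul_commutator, smul_eq_mul, pow_mul_trace_eq_zero (b := b) hϖ,
        AddChar.map_zero_eq_one, Units.val_one]
      exact mul_mem_parahoricRad_left (sub_mem (mul_mem hβ ha) (mul_mem ha hβ)) hd
    have e3 : (⟨y * (c * u) * y⁻¹, hm⟩ : groupH (Ideal.span {ϖ}) b β l) =
        ⟨_, congruenceSubgroup_le_groupH m1⟩⁻¹ * ⟨c, centralizer_le_groupH hc⟩ *
          (⟨_, congruenceSubgroup_le_groupH m2⟩ * ⟨u, congruenceSubgroup_le_groupH hu⟩) :=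
      Subtype.ext (by simp; group)
    rw [e3, map_mul, map_mul, map_mul, map_inv, e1, e2, inv_one, one_mul, one_mul, ← map_mul]
    rfl
  obtain ⟨c, hc, y, hy, rfl⟩ := exists_mul_of_mem_groupJ hb he hl hx
  have hy' : y ∈ groupJ (Ideal.span {ϖ}) b β l := Subgroup.mem_sup_right hy
  have hm := conj_mem_groupH hb he hl hy' s.2
  have e3 : (⟨c * y * s * (c * y)⁻¹, conj_mem_groupH hb he hl hx s.2⟩ :
      groupH (Ideal.span {ϖ}) b β l) = ⟨c, centralizer_le_groupH hc⟩ * ⟨_, hm⟩ *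
        ⟨c, centralizer_le_groupH hc⟩⁻¹ := Subtype.ext (by simp; group)
  rw [e3, map_mul, map_mul, map_inv, mul_comm (θ _), mul_inv_cancel_right]
  exact key y hy s s.2 hm

theorem inv_mul_mem_congruenceSubgroup (hb : Function.Surjective b) {g h : GL (Fin N) R}
    (hg : g ∈ congruenceSubgroup (Ideal.span {ϖ}) b 1) {z : Matrix (Fin N) (Fin N) R}
    (hz : z ∈ parahoricRad (Ideal.span {ϖ}) b)
    (hgh : (h : Matrix (Fin N) (Fin N) R) = g + ϖ ^ l • z) :
    g⁻¹ * h ∈ congruenceSubgroup (Ideal.span {ϖ}) b (e * l + 1) := by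
  refine (mem_congruenceSubgroup_mul_add_one_iff hb).2 ⟨_, mul_mem_parahoricRad_left
    (inv_mem_parahoric_of_mem_congruenceSubgroup_one hg) hz, ?_⟩
  rw [Units.val_mul, hgh, mul_add, Units.inv_mul, Matrix.mul_smul]

theorem unitOneAdd_mem_groupJ (hb : Function.Surjective b) (he : 0 < e) (hl : 0 < l)
    (hϖ : ϖ ^ (2 * l + 1) = 0) {a : Matrix (Fin N) (Fin N) R}
    (ha : a ∈ parahoric (Ideal.span {ϖ}) b) :
    unitOneAdd hl hϖ a ∈ groupJ (Ideal.span {ϖ}) b β l :=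
  Subgroup.mem_sup_right (unitOneAdd_mem hb he hl hϖ ha)

/-- The surjective homomorphism `a ↦ (1 + ϖ ^ l a) H` from `𝔄` to `J / H`. -/
noncomputable def parahoricToQuotient (hb : Function.Surjective b) (he : 0 < e) (hl : 0 < l)
    (hϖ : ϖ ^ (2 * l + 1) = 0)
    [((groupH (Ideal.span {ϖ}) b β l).subgroupOf (groupJ (Ideal.span {ϖ}) b β l)).Normal] :
    Multiplicative (parahoric (Ideal.span {ϖ}) b) →*
      groupJ (Ideal.span {ϖ}) b β l ⧸
        (groupH (Ideal.span {ϖ}) b β l).subgroupOf (groupJ (Ideal.span {ϖ}) b β l) :=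
  MonoidHom.mk' (fun a => QuotientGroup.mk
    ⟨unitOneAdd hl hϖ (a.toAdd : Matrix (Fin N) (Fin N) R),
      unitOneAdd_mem_groupJ hb he hl hϖ a.toAdd.2⟩) fun a a' => by
    rw [← QuotientGroup.mk_mul, QuotientGroup.eq]
    refine congruenceSubgroup_le_groupH (inv_mul_mem_congruenceSubgroup hb
      (congruenceSubgroup_mul_le_one hb he hl (unitOneAdd_mem hb he hl hϖ (a * a').toAdd.2))
      (z := ϖ ^ l • ((a.toAdd : Matrix (Fin N) (Fin N) R) * a'.toAdd)) ?_ ?_)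
    · intro i j _
      exact Ideal.mul_mem_right _ _ (Ideal.pow_mem_of_mem _ (Ideal.mem_span_singleton_self ϖ) _ hl)
    · rw [Subgroup.coe_mul, Units.val_mul, val_unitOneAdd, val_unitOneAdd, val_unitOneAdd,
        toAdd_mul, AddMemClass.coe_add]
      simp only [mul_add, add_mul, mul_one, one_mul, Matrix.smul_mul, Matrix.mul_smul, smul_add]
      abel

theorem parahoricToQuotient_surjective (hb : Function.Surjective b) (he : 0 < e) (hl : 0 < l)
    (hϖ : ϖ ^ (2 * l + 1) = 0)
    [((groupH (Ideal.span {ϖ}) b β l).subgroupOf (groupJ (Ideal.span {ϖ}) b β l)).Normal] :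
    Function.Surjective (parahoricToQuotient (β := β) hb he hl hϖ) := by
  intro x
  induction x using QuotientGroup.induction_on with | _ x => ?_
  obtain ⟨x, hx⟩ := x
  obtain ⟨c, hc, u, hu, rfl⟩ := exists_mul_of_mem_groupJ hb he hl hx
  obtain ⟨a, ha, h⟩ := (mem_congruenceSubgroup_mul_iff hb he hl).1 hu
  refine ⟨Multiplicative.ofAdd ⟨a, ha⟩, ?_⟩
  have h1 : unitOneAdd hl hϖ a = u := Units.ext h.symm
  have h2 : (⟨c * u, hx⟩ : groupJ (Ideal.span {ϖ}) b β l) =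
      ⟨c, Subgroup.mem_sup_left hc⟩ * ⟨u, Subgroup.mem_sup_right hu⟩ := rfl
  have h3 : ((⟨c, Subgroup.mem_sup_left hc⟩ : groupJ (Ideal.span {ϖ}) b β l) :
      groupJ (Ideal.span {ϖ}) b β l ⧸ (groupH (Ideal.span {ϖ}) b β l).subgroupOf
        (groupJ (Ideal.span {ϖ}) b β l)) = 1 :=
    (QuotientGroup.eq_one_iff _).2 (centralizer_le_groupH hc)
  rw [h2, QuotientGroup.mk_mul, h3, one_mul]
  simp only [← h1]
  rfl

/-- The elements of `𝔄` that commute with `β` modulo `𝔓`. -/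
def commuteModRad (hβ : β ∈ parahoric (Ideal.span {ϖ}) b) :
    AddSubgroup (parahoric (Ideal.span {ϖ}) b) :=
  (Subring.centralizer {Ideal.Quotient.mk (parahoricIdeal (Ideal.span {ϖ}) b)
    ⟨β, hβ⟩}).toAddSubgroup.comap
      (Ideal.Quotient.mk (parahoricIdeal (Ideal.span {ϖ}) b)).toAddMonoidHom

omit [Finite R] in
theorem mem_commuteModRad_iff {hβ : β ∈ parahoric (Ideal.span {ϖ}) b}
    {a : parahoric (Ideal.span {ϖ}) b} :
    a ∈ commuteModRad hβ ↔
      β * (a : Matrix (Fin N) (Fin N) R) - a * β ∈ parahoricRad (Ideal.span {ϖ}) b := by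
  have h1 : a ∈ commuteModRad hβ ↔
      Ideal.Quotient.mk (parahoricIdeal (Ideal.span {ϖ}) b) a ∈
        Subring.centralizer {Ideal.Quotient.mk (parahoricIdeal (Ideal.span {ϖ}) b) ⟨β, hβ⟩} :=
    Iff.rfl
  rw [h1, Subring.mem_centralizer_iff]
  simp only [Set.mem_singleton_iff, forall_eq]
  rw [← map_mul, ← map_mul, Ideal.Quotient.eq]
  rfl

omit [Finite R] in
theorem index_commuteModRad (hβ : β ∈ parahoric (Ideal.span {ϖ}) b) :
    (commuteModRad hβ).index = Nat.card (CentralizerQuotient (Ideal.span {ϖ}) b ⟨β, hβ⟩) :=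
  AddSubgroup.index_comap_of_surjective _ Ideal.Quotient.mk_surjective

/-- The commutator form corresponds to `(a, d) ↦ Λ (ϖ ^ (2 l) tr ((β a - a β) d))` on `𝔄`, whose
radical consists of the elements that commute with `β` modulo `𝔓`. -/
theorem exists_commutatorForm_groupJ (hb : Function.Surjective b) (he : 0 < e)
    (hl : 0 < l) (hϖ : ϖ ^ (2 * l + 1) = 0) (hβ : β ∈ parahoric (Ideal.span {ϖ}) b)
    {Λ : AddChar R ℂ} (hΛ : ∀ a, (∀ y, Λ (ϖ ^ (2 * l) * (a * y)) = 1) → ϖ ∣ a)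
    (θ : groupH (Ideal.span {ϖ}) b β l →* ℂˣ)
    (hθ : ∀ g : groupH (Ideal.span {ϖ}) b β l,
      (g : GL (Fin N) R) ∈ congruenceSubgroup (Ideal.span {ϖ}) b (e * l + 1) →
        (θ g : ℂ) = Λ (β * ((g : GL (Fin N) R) - 1 : Matrix (Fin N) (Fin N) R)).trace) :
    ∃ (_ : ((groupH (Ideal.span {ϖ}) b β l).subgroupOf (groupJ (Ideal.span {ϖ}) b β l)).Normal)
      (form : _ →* (_ →* ℂˣ)),
      IsCommutatorForm (groupJ (Ideal.span {ϖ}) b β l) (groupH (Ideal.span {ϖ}) b β l) θ form ∧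
      (formRadical _ _ form).relIndex (groupJ (Ideal.span {ϖ}) b β l) =
        (commuteModRad hβ).index ∧
      ∀ a ∈ form.ker, ∃ a' ∈ commuteModRad hβ,
        parahoricToQuotient hb he hl hϖ (Multiplicative.ofAdd a') = a := by
  have hN : ((groupH (Ideal.span {ϖ}) b β l).subgroupOf
      (groupJ (Ideal.span {ϖ}) b β l)).Normal :=
    ⟨fun s hs x => conj_mem_groupH hb he hl x.2 hs⟩
  have hsurj := parahoricToQuotient_surjective (β := β) hb he hl hϖ
  have hinv : ∀ x ∈ groupJ (Ideal.span {ϖ}) b β l, ∀ s : groupH (Ideal.span {ϖ}) b β l,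
      ∃ h : x * s * x⁻¹ ∈ groupH (Ideal.span {ϖ}) b β l, θ ⟨_, h⟩ = θ s :=
    fun x hx s => ⟨_, apply_conj_eq_of_extends hb he hl hϖ hβ hθ hx s⟩
  have hcomm : ∀ x ∈ groupJ (Ideal.span {ϖ}) b β l, ∀ y ∈ groupJ (Ideal.span {ϖ}) b β l,
      x * y * x⁻¹ * y⁻¹ ∈ groupH (Ideal.span {ϖ}) b β l :=
    fun x hx y hy => commutator_mem_of_surjective hsurj hx hy
  obtain ⟨form, hform⟩ := exists_isCommutatorForm θ hinv hcomm
  have hval : ∀ a d : parahoric (Ideal.span {ϖ}) b,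
      (form (parahoricToQuotient hb he hl hϖ (Multiplicative.ofAdd a))
        (parahoricToQuotient hb he hl hϖ (Multiplicative.ofAdd d)) : ℂ) =
      Λ (ϖ ^ (2 * l) * ((β * (a : Matrix (Fin N) (Fin N) R) - a * β) * d).trace) := by
    intro a d
    obtain ⟨h, hh⟩ := hform
      ⟨unitOneAdd hl hϖ (a : Matrix (Fin N) (Fin N) R), unitOneAdd_mem_groupJ hb he hl hϖ a.2⟩
      ⟨unitOneAdd hl hϖ (d : Matrix (Fin N) (Fin N) R), unitOneAdd_mem_groupJ hb he hl hϖ d.2⟩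
    have e1 := val_commutator_eq hl hϖ (val_unitOneAdd hl hϖ (a : Matrix (Fin N) (Fin N) R))
      (val_unitOneAdd hl hϖ (d : Matrix (Fin N) (Fin N) R))
    have hmem : unitOneAdd hl hϖ (a : Matrix (Fin N) (Fin N) R) *
        unitOneAdd hl hϖ (d : Matrix (Fin N) (Fin N) R) *
        (unitOneAdd hl hϖ (a : Matrix (Fin N) (Fin N) R))⁻¹ *
        (unitOneAdd hl hϖ (d : Matrix (Fin N) (Fin N) R))⁻¹ ∈
        congruenceSubgroup (Ideal.span {ϖ}) b (e * l + 1) := by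
      refine (mem_congruenceSubgroup_mul_add_one_iff hb).2 ⟨ϖ ^ l •
        ((a * d : parahoric (Ideal.span {ϖ}) b) - (d * a : parahoric (Ideal.span {ϖ}) b) :
          Matrix (Fin N) (Fin N) R), ?_, ?_⟩
      · intro i j _
        exact Ideal.mul_mem_right _ _
          (Ideal.pow_mem_of_mem _ (Ideal.mem_span_singleton_self ϖ) _ hl)
      · rw [e1, smul_smul, ← pow_add, ← two_mul]
        rfl
    refine (congrArg Units.val hh).trans ((hθ ⟨_, congruenceSubgroup_le_groupH hmem⟩ hmem).trans ?_)
    rw [e1, add_sub_cancel_left, Matrix.mul_smul, Matrix.trace_smul, trace_mul_commutator,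
      smul_eq_mul]
  have hker : ∀ a : parahoric (Ideal.span {ϖ}) b,
      form (parahoricToQuotient hb he hl hϖ (Multiplicative.ofAdd a)) = 1 ↔
        a ∈ commuteModRad hβ := by
    intro a
    rw [mem_commuteModRad_iff, mem_parahoricRad_iff_forall_addChar hϖ hΛ]
    constructor
    · intro h d hd
      rw [← hval a ⟨d, hd⟩, h]
      rfl
    · intro h
      refine MonoidHom.ext fun z => Units.ext ?_
      obtain ⟨d, rfl⟩ := hsurj z
      exact (hval a d.toAdd).trans (h _ d.toAdd.2)
  refine ⟨hN, form, hform, ?_, ?_⟩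
  · rw [relIndex_formRadical, ← Subgroup.index_comap_of_surjective _ hsurj,
      ← AddSubgroup.index_toSubgroup]
    congr 1
    ext a
    exact hker a.toAdd
  · intro x hx
    obtain ⟨a, rfl⟩ := hsurj x
    exact ⟨a.toAdd, (hker a.toAdd).1 hx, rfl⟩

end FormOnJ

/-! ### Counting centralisers -/

section Centralizers

open Polynomial

theorem Nat.card_centralizer_congr {K A B : Type*} [CommSemiring K] [Semiring A] [Semiring B]
    [Algebra K A] [Algebra K B] (φ : A ≃ₐ[K] B) (a : A) :
    Nat.card (Subalgebra.centralizer K {a}) = Nat.card (Subalgebra.centralizer K {φ a}) := by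
  refine Nat.card_congr (φ.toEquiv.subtypeEquiv fun x => ?_)
  change x ∈ Subalgebra.centralizer K {a} ↔ φ x ∈ Subalgebra.centralizer K {φ a}
  simp only [Subalgebra.mem_centralizer_iff, Set.mem_singleton_iff, forall_eq, ← map_mul,
    φ.injective.eq_iff]

/-- A matrix with irreducible characteristic polynomial has every nonzero vector `v` as a cyclic
vector, so evaluation at `v` identifies its centraliser with the space of vectors. -/
theorem Matrix.card_centralizer_of_irreducible_charpoly {K n : Type*} [Field K] [Finite K]
    [Fintype n] [DecidableEq n] (B : Matrix n n K) (hB : Irreducible B.charpoly) :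
    Nat.card (Subalgebra.centralizer K {B}) = Nat.card K ^ Fintype.card n := by
  have hpos : 0 < Fintype.card n := by
    rw [← B.charpoly_natDegree_eq_dim]
    exact hB.natDegree_pos
  have hne : Nonempty n := Fintype.card_pos_iff.1 hpos
  obtain ⟨v, hv⟩ := exists_ne (0 : n → K)
  let φ : degreeLT K (Fintype.card n) →ₗ[K] (n → K) :=
    { toFun := fun p => (aeval B (p : K[X])).mulVec v
      map_add' := fun p q => by simp [Matrix.add_mulVec]
      map_smul' := fun c p => by simp [Matrix.smul_mulVec] }
  have hφ : Function.Injective φ := by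
    rw [injective_iff_map_eq_zero]
    rintro ⟨p, hp⟩ h
    change (aeval B p).mulVec v = 0 at h
    by_contra hp0
    have hp0' : p ≠ 0 := fun h => hp0 (Subtype.ext h)
    have hnd : ¬ B.charpoly ∣ p := by
      intro hd
      have h1 := natDegree_le_of_dvd hd hp0'
      rw [B.charpoly_natDegree_eq_dim] at h1
      rw [mem_degreeLT, degree_eq_natDegree hp0', Nat.cast_lt] at hp
      omega
    obtain ⟨s, t, hst⟩ := (hB.coprime_iff_not_dvd).2 hnd
    refine hv ?_
    have h2 := congrArg (fun q => (aeval B q).mulVec v) hst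
    simp only [map_add, map_mul, Matrix.aeval_self_charpoly, mul_zero, zero_add, map_one,
      Matrix.one_mulVec, ← Matrix.mulVec_mulVec, h, Matrix.mulVec_zero] at h2
    exact h2.symm
  have hφs : Function.Surjective φ := by
    rw [← LinearMap.injective_iff_surjective_of_finrank_eq_finrank]
    · exact hφ
    · rw [(degreeLTEquiv K (Fintype.card n)).finrank_eq, Module.finrank_fin_fun,
        Module.finrank_fintype_fun_eq_card]
  have hcomm : ∀ p : K[X], ∀ X : Subalgebra.centralizer K {B},
      Commute (X : Matrix n n K) (aeval B p) := by
    intro p X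
    have h1 : Commute (X : Matrix n n K) B :=
      ((Subalgebra.mem_centralizer_iff K).1 X.2 B rfl).symm
    induction p using Polynomial.induction_on' with
    | add p q hp hq => rw [map_add]; exact hp.add_right hq
    | monomial k c =>
      rw [aeval_monomial]
      exact (Algebra.commute_algebraMap_right c (X : Matrix n n K)).mul_right (h1.pow_right k)
  have hbij : Function.Bijective fun X : Subalgebra.centralizer K {B} =>
      (X : Matrix n n K).mulVec v := by
    constructor
    · intro X Y hXY
      apply Subtype.ext
      apply Matrix.mulVec_injective
      funext w
      obtain ⟨p, rfl⟩ := hφs w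
      change (X : Matrix n n K).mulVec ((aeval B (p : K[X])).mulVec v) =
        (Y : Matrix n n K).mulVec ((aeval B (p : K[X])).mulVec v)
      rw [Matrix.mulVec_mulVec, Matrix.mulVec_mulVec, (hcomm p X).eq, (hcomm p Y).eq,
        ← Matrix.mulVec_mulVec, ← Matrix.mulVec_mulVec]
      exact congrArg _ hXY
    · intro w
      obtain ⟨p, hp⟩ := hφs w
      refine ⟨⟨aeval B (p : K[X]), ?_⟩, hp⟩
      rw [Subalgebra.mem_centralizer_iff]
      intro B' hB'
      rw [Set.mem_singleton_iff.1 hB']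
      simpa using congrArg (aeval B) (mul_comm X (p : K[X]))
  rw [Nat.card_congr (Equiv.ofBijective _ hbij), Nat.card_fun, Nat.card_eq_fintype_card (α := n)]

end Centralizers

section Index

variable {R : Type u} [CommRing R] {ϖ : R} {N e : ℕ} {b : Fin N → Fin e}
  {β : Matrix (Fin N) (Fin N) R} {K : Type*} [Field K] {π : R →+* K}

theorem toSquareBlock_map_mul (hπ : ∀ x, π x = 0 ↔ ϖ ∣ x) {x y : Matrix (Fin N) (Fin N) R}
    (hx : x ∈ parahoric (Ideal.span {ϖ}) b) (hy : y ∈ parahoric (Ideal.span {ϖ}) b) (z : Fin e) :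
    ((x * y).map π).toSquareBlock b z =
      (x.map π).toSquareBlock b z * (y.map π).toSquareBlock b z := by
  ext ⟨i, hi⟩ ⟨j, hj⟩
  rw [Matrix.mul_apply]
  simp only [Matrix.toSquareBlock_def, Matrix.of_apply, Matrix.map_apply, Matrix.mul_apply,
    map_sum, map_mul]
  rw [← Finset.sum_subtype (Finset.univ.filter fun k => b k = z) (by simp)
    fun k => π (x i k) * π (y k j), Finset.sum_filter_of_ne]
  intro k _
  contrapose!
  intro hk
  rcases lt_or_gt_of_ne hk with h | h
  · rw [(hπ (x i k)).2 (Ideal.mem_span_singleton.1 (hx i k (hi ▸ h))), zero_mul]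
  · rw [(hπ (y k j)).2 (Ideal.mem_span_singleton.1 (hy k j (hj ▸ h))), mul_zero]

/-- The reduction of `𝔄` onto the product of its diagonal blocks, with kernel `𝔓`. -/
def blockReduce (b : Fin N → Fin e) (π : R →+* K) :
    parahoric (Ideal.span {ϖ}) b →+ ((z : Fin e) → Matrix {i // b i = z} {i // b i = z} K) where
  toFun a z := ((a : Matrix (Fin N) (Fin N) R).map π).toSquareBlock b z
  map_zero' := by ext; simp [Matrix.toSquareBlock_def]
  map_add' x y := by ext; simp [Matrix.toSquareBlock_def]

theorem blockReduce_surjective (hπs : Function.Surjective π) :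
    Function.Surjective (blockReduce (ϖ := ϖ) b π) := by
  intro M
  let a : Matrix (Fin N) (Fin N) R := Matrix.of fun i j =>
    if h : b j = b i then Function.surjInv hπs (M (b i) ⟨i, rfl⟩ ⟨j, h⟩) else 0
  have ha : a ∈ parahoric (Ideal.span {ϖ}) b := by
    intro i j hij
    simp only [a, Matrix.of_apply, dif_neg hij.ne]
    exact Ideal.zero_mem _
  refine ⟨⟨a, ha⟩, ?_⟩
  funext z
  ext ⟨i, rfl⟩ ⟨j, hj⟩
  change π (a i j) = _
  simp only [a, Matrix.of_apply, dif_pos hj, Function.surjInv_eq]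

theorem mem_commuteModRad_iff_blockReduce (hπ : ∀ x, π x = 0 ↔ ϖ ∣ x)
    (hβ : β ∈ parahoric (Ideal.span {ϖ}) b) (a : parahoric (Ideal.span {ϖ}) b) :
    a ∈ commuteModRad hβ ↔ ∀ z, blockReduce b π a z ∈
      Subalgebra.centralizer K {(β.map π).toSquareBlock b z} := by
  have hc : β * (a : Matrix (Fin N) (Fin N) R) - a * β ∈ parahoric (Ideal.span {ϖ}) b :=
    sub_mem (mul_mem hβ a.2) (mul_mem a.2 hβ)
  have h1 : ∀ z, blockReduce b π a z ∈ Subalgebra.centralizer K {(β.map π).toSquareBlock b z} ↔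
      ((β * (a : Matrix (Fin N) (Fin N) R)).map π).toSquareBlock b z =
        (((a : Matrix (Fin N) (Fin N) R) * β).map π).toSquareBlock b z := by
    intro z
    rw [toSquareBlock_map_mul hπ hβ a.2, toSquareBlock_map_mul hπ a.2 hβ,
      Subalgebra.mem_centralizer_iff]
    simp only [Set.mem_singleton_iff, forall_eq]
    rfl
  simp only [h1, mem_commuteModRad_iff]
  constructor
  · intro h z
    ext ⟨i, hi⟩ ⟨j, hj⟩
    have h2 := (hπ _).2 (Ideal.mem_span_singleton.1 (h i j (hj.trans hi.symm).le))
    rw [Matrix.sub_apply, map_sub] at h2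
    exact sub_eq_zero.1 h2
  · intro h i j hij
    rcases hij.lt_or_eq with h2 | h2
    · exact hc i j h2
    · refine Ideal.mem_span_singleton.2 ((hπ _).1 ?_)
      rw [Matrix.sub_apply, map_sub]
      exact sub_eq_zero.2 (congrFun (congrFun (h (b i)) ⟨i, rfl⟩) ⟨j, h2⟩)

/-- The index is computed block by block in `𝔄 / 𝔓`. -/
theorem index_commuteModRad_mul_prod [Finite K] (hπ : ∀ x, π x = 0 ↔ ϖ ∣ x)
    (hπs : Function.Surjective π) (hβ : β ∈ parahoric (Ideal.span {ϖ}) b) :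
    (commuteModRad hβ).index *
        ∏ z, Nat.card (Subalgebra.centralizer K {(β.map π).toSquareBlock b z}) =
      ∏ z, Nat.card K ^ (Fintype.card {i // b i = z}) ^ 2 := by
  let S : AddSubgroup ((z : Fin e) → Matrix {i // b i = z} {i // b i = z} K) :=
    AddSubgroup.pi Set.univ fun z =>
      (Subalgebra.centralizer K {(β.map π).toSquareBlock b z}).toSubmodule.toAddSubgroup
  have hS : ∀ M, M ∈ S ↔ ∀ z, M z ∈ Subalgebra.centralizer K {(β.map π).toSquareBlock b z} := by
    intro M
    rw [AddSubgroup.mem_pi]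
    simp only [Set.mem_univ, true_imp_iff]
    rfl
  have h1 : commuteModRad hβ = S.comap (blockReduce b π) := by
    ext a
    rw [AddSubgroup.mem_comap, hS, mem_commuteModRad_iff_blockReduce hπ]
  have h2 : ∏ z, Nat.card (Subalgebra.centralizer K {(β.map π).toSquareBlock b z}) =
      Nat.card S := by
    rw [← Nat.card_pi]
    exact Nat.card_congr ((Equiv.subtypeEquivRight hS).trans Equiv.subtypePiEquivPi).symm
  rw [h1, AddSubgroup.index_comap_of_surjective _ (blockReduce_surjective hπs), h2, mul_comm,
    AddSubgroup.card_mul_index, Nat.card_pi]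
  refine Finset.prod_congr rfl fun z _ => ?_
  rw [show Matrix {i // b i = z} {i // b i = z} K = ({i // b i = z} → {i // b i = z} → K) from rfl,
    Nat.card_fun, Nat.card_fun, Nat.card_eq_fintype_card (α := {i // b i = z}), ← pow_mul, sq]

end Index

section Regular

variable {R : Type u} [CommRing R] [Finite R] {ϖ : R} {N L : ℕ}
  {β : Matrix (Fin N) (Fin N) R} {K : Type*} [Field K] {π : R →+* K}

omit [Finite R] in
theorem map_mul_comm_iff (hϖ : ϖ ^ (L + 1) = 0) (hπ : ∀ x, π x = 0 ↔ ϖ ∣ x)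
    (hL : ∀ x, ϖ ^ L * x = 0 → ϖ ∣ x) (y : Matrix (Fin N) (Fin N) R) :
    (β.map π) * (y.map π) = (y.map π) * (β.map π) ↔
      β * (ϖ ^ L • y) = (ϖ ^ L • y) * β := by
  rw [← Matrix.map_mul, ← Matrix.map_mul, Matrix.mul_smul, Matrix.smul_mul, ← Matrix.ext_iff,
    ← Matrix.ext_iff]
  refine forall_congr' fun i => forall_congr' fun j => ?_
  rw [Matrix.map_apply, Matrix.map_apply, Matrix.smul_apply, Matrix.smul_apply, ← sub_eq_zero,
    ← map_sub, hπ, smul_eq_mul, smul_eq_mul, ← sub_eq_zero (a := _ * _), ← mul_sub]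
  refine ⟨?_, hL _⟩
  rintro ⟨t, ht⟩
  rw [ht, ← mul_assoc, ← pow_succ, hϖ, zero_mul]

/-- For a regular `β`, every matrix over the residue field commuting with the reduction of `β` lifts
to a matrix commuting with `β`.  Indeed the `ϖ`-torsion of the centraliser consists of the multiples
by `ϖ ^ L` of lifts of such matrices, and in a free module it is the image of `ϖ ^ L`. -/
theorem IsRegularMatrix.exists_lift_commute (hreg : IsRegularMatrix β) (hϖ : ϖ ^ (L + 1) = 0)
    (hπ : ∀ x, π x = 0 ↔ ϖ ∣ x) (hπs : Function.Surjective π)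
    (hL : ∀ x, ϖ ^ L * x = 0 → ϖ ∣ x) (hL' : ∀ x, ϖ * x = 0 → ϖ ^ L ∣ x)
    {M : Matrix (Fin N) (Fin N) K} (hM : β.map π * M = M * β.map π) :
    ∃ c ∈ Subalgebra.centralizer R {β}, c.map π = M := by
  obtain ⟨y, rfl⟩ : ∃ y : Matrix (Fin N) (Fin N) R, y.map π = M :=
    ⟨M.map (Function.surjInv hπs), by ext i j; simp [Function.surjInv_eq]⟩
  have h1 := (map_mul_comm_iff hϖ hπ hL y).1 hM
  have := hreg.1
  let B := Module.Free.chooseBasis R (Subalgebra.centralizer R {β})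
  let c₀ : Subalgebra.centralizer R {β} :=
    ⟨ϖ ^ L • y, by rw [Subalgebra.mem_centralizer_iff]; rintro _ rfl; exact h1⟩
  have h2 : ϖ • c₀ = 0 := by
    apply Subtype.ext
    change ϖ • ϖ ^ L • y = 0
    rw [smul_smul, ← pow_succ', hϖ, zero_smul]
  have h3 : ∀ i, ϖ ^ L ∣ B.repr c₀ i := by
    intro i
    apply hL'
    have := congrArg (fun v => B.repr v i) h2
    simpa using this
  choose w hw using h3
  have h4 : ϖ ^ L • (B.equivFun.symm w) = c₀ := by
    apply B.equivFun.injective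
    rw [map_smul, LinearEquiv.apply_symm_apply]
    funext i
    rw [Pi.smul_apply, smul_eq_mul, ← hw, B.equivFun_apply]
  refine ⟨B.equivFun.symm w, (B.equivFun.symm w).2, ?_⟩
  have h5 : ϖ ^ L • ((B.equivFun.symm w : Subalgebra.centralizer R {β}) : Matrix _ _ R) =
      ϖ ^ L • y := congrArg Subtype.val h4
  ext i j
  rw [Matrix.map_apply, Matrix.map_apply, ← sub_eq_zero, ← map_sub, hπ]
  apply hL
  rw [mul_sub, sub_eq_zero]
  exact congrFun (congrFun h5 i) j

theorem IsRegularMatrix.card_centralizer (hreg : IsRegularMatrix β) (hϖ : ϖ ^ (L + 1) = 0)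
    (hπ : ∀ x, π x = 0 ↔ ϖ ∣ x) (hπs : Function.Surjective π)
    (hL : ∀ x, ϖ ^ L * x = 0 → ϖ ∣ x) (hL' : ∀ x, ϖ * x = 0 → ϖ ^ L ∣ x) :
    Nat.card (Subalgebra.centralizer K {β.map π}) = Nat.card K ^ N := by
  have := hreg.1
  have : Nontrivial R := π.domain_nontrivial
  have hL0 : ∀ x, ϖ ^ L * x = 0 ↔ π x = 0 := by
    intro x
    rw [hπ]
    refine ⟨hL x, ?_⟩
    rintro ⟨t, rfl⟩
    rw [← mul_assoc, ← pow_succ, hϖ, zero_mul]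
  let B := Module.finBasisOfFinrankEq R (Subalgebra.centralizer R {β}) hreg.2
  -- Reduction of the centraliser, and reduction of coordinates, have the same kernel: the elements
  -- killed by `ϖ ^ L`.
  let f : Subalgebra.centralizer R {β} →+ Matrix (Fin N) (Fin N) K :=
    π.mapMatrix.toAddMonoidHom.comp (Subalgebra.centralizer R {β}).val.toAddMonoidHom
  let g : Subalgebra.centralizer R {β} →+ (Fin N → K) :=
    (π.toAddMonoidHom.compLeft (Fin N)).comp B.equivFun.toAddMonoidHom
  have hf : ∀ c, f c = 0 ↔ ϖ ^ L • c = 0 := by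
    intro c
    rw [← Subtype.coe_injective.eq_iff, ← Matrix.ext_iff, ← Matrix.ext_iff]
    exact forall_congr' fun i => forall_congr' fun j => (hL0 _).symm
  have hg : ∀ c, g c = 0 ↔ ϖ ^ L • c = 0 := by
    intro c
    rw [← B.equivFun.map_eq_zero_iff, funext_iff, funext_iff]
    refine forall_congr' fun i => ?_
    rw [map_smul]
    exact (hL0 _).symm
  have hker : f.ker = g.ker := by
    ext c
    rw [AddMonoidHom.mem_ker, AddMonoidHom.mem_ker, hf, hg]
  have hgs : Function.Surjective g := by
    intro v
    refine ⟨B.equivFun.symm (Function.surjInv hπs ∘ v), ?_⟩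
    funext i
    change π (B.equivFun (B.equivFun.symm _) i) = v i
    rw [LinearEquiv.apply_symm_apply]
    exact Function.surjInv_eq hπs _
  have h1 : Nat.card f.range = Nat.card (Subalgebra.centralizer K {β.map π}) := by
    refine Nat.card_congr (Equiv.subtypeEquivRight fun M => ?_)
    rw [Subalgebra.mem_centralizer_iff]
    simp only [Set.mem_singleton_iff, forall_eq]
    constructor
    · rintro ⟨c, rfl⟩
      have h2 := (Subalgebra.mem_centralizer_iff R).1 c.2 β rfl
      have h3 := congrArg (fun M : Matrix (Fin N) (Fin N) R => M.map π) h2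
      simp only [Matrix.map_mul] at h3
      exact h3
    · intro hM
      obtain ⟨c, hc, h⟩ := hreg.exists_lift_commute hϖ hπ hπs hL hL' hM
      exact ⟨⟨c, hc⟩, h⟩
  rw [← h1, ← AddSubgroup.index_ker, hker, AddSubgroup.index_ker,
    AddMonoidHom.range_eq_top.2 hgs, AddSubgroup.card_top, Nat.card_fun,
    Nat.card_eq_fintype_card (α := Fin N), Fintype.card_fin]

end Regular

/-! ### The two parahoric algebras attached to a regular matrix -/

section Abstract

variable {R : Type u} [CommRing R] [Finite R] {ϖ : R} {N l : ℕ}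
  {β : Matrix (Fin N) (Fin N) R} {K : Type*} [Field K] [Finite K] {π : R →+* K}

theorem two_mul_triangle_add (n : ℕ) : 2 * (n * (n - 1) / 2) + n = n ^ 2 := by
  rw [Nat.two_mul_div_two_of_even (Nat.even_mul_pred_self n)]
  rcases n with _ | n
  · rfl
  · rw [Nat.add_sub_cancel]; ring

theorem two_mul_mul_triangle_add (n m : ℕ) : 2 * (n * m * (n - 1) / 2) + n * m = n ^ 2 * m := by
  have h : n * m * (n - 1) = n * (n - 1) * m := by ring
  rw [Nat.two_mul_div_two_of_even (h ▸ (Nat.even_mul_pred_self n).mul_right m), h]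
  rcases n with _ | n
  · simp
  · rw [Nat.add_sub_cancel]; ring

theorem maxBlock_surjective (hN : 0 < N) : Function.Surjective (maxBlock N) :=
  fun _ => ⟨⟨0, hN⟩, Subsingleton.elim _ _⟩

/-- The index is `q ^ (N ^ 2 - N)`, from the `q ^ N` matrices commuting with the reduction of `β`. -/
theorem sq_eq_index_commuteModRad_maxBlock (hreg : IsRegularMatrix β) {L : ℕ}
    (hϖ : ϖ ^ (L + 1) = 0) (hπ : ∀ x, π x = 0 ↔ ϖ ∣ x) (hπs : Function.Surjective π)
    (hL : ∀ x, ϖ ^ L * x = 0 → ϖ ∣ x) (hL' : ∀ x, ϖ * x = 0 → ϖ ^ L ∣ x) :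
    (Nat.card K ^ (N * (N - 1) / 2)) ^ 2 =
      (commuteModRad (mem_parahoric_maxBlock (Ideal.span {ϖ}) β)).index := by
  have h1 := index_commuteModRad_mul_prod hπ hπs (mem_parahoric_maxBlock (Ideal.span {ϖ}) β)
  let ε : {i // maxBlock N i = 0} ≃ Fin N := Equiv.subtypeUnivEquiv fun _ => rfl
  have h2 := Nat.card_centralizer_congr (Matrix.reindexAlgEquiv K K ε)
    ((β.map π).toSquareBlock (maxBlock N) 0)
  rw [show Matrix.reindexAlgEquiv K K ε ((β.map π).toSquareBlock (maxBlock N) 0) = β.map π from rfl,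
    hreg.card_centralizer hϖ hπ hπs hL hL'] at h2
  rw [Fin.prod_univ_one, Fin.prod_univ_one, h2, Fintype.card_congr ε, Fintype.card_fin] at h1
  refine Nat.eq_of_mul_eq_mul_right (pow_pos (Nat.card_pos (α := K)) N) (Eq.trans ?_ h1.symm)
  rw [← pow_mul, ← pow_add, mul_comm _ 2, two_mul_triangle_add]

omit [Finite K] in
/-- For `𝔄 = M_N`, an element of the radical of the form is represented by `1 + ϖ ^ l a` where `a`
commutes with `β` modulo `ϖ`; by regularity `a` may be changed to commute with `β`, so that
`1 + ϖ ^ l a ∈ C ∩ U^1`. -/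
theorem parahoricToQuotient_maxBlock_eq_one (hN : 0 < N) (hl : 0 < l)
    (hreg : IsRegularMatrix β) (hϖ : ϖ ^ (2 * l + 1) = 0) (hπ : ∀ x, π x = 0 ↔ ϖ ∣ x)
    (hπs : Function.Surjective π)
    (hL : ∀ x, ϖ ^ (2 * l) * x = 0 → ϖ ∣ x) (hL' : ∀ x, ϖ * x = 0 → ϖ ^ (2 * l) ∣ x)
    [((groupH (Ideal.span {ϖ}) (maxBlock N) β l).subgroupOf
      (groupJ (Ideal.span {ϖ}) (maxBlock N) β l)).Normal]
    {a : parahoric (Ideal.span {ϖ}) (maxBlock N)}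
    (ha : a ∈ commuteModRad (mem_parahoric_maxBlock (Ideal.span {ϖ}) β)) :
    parahoricToQuotient (β := β) (maxBlock_surjective hN) zero_lt_one hl hϖ
      (Multiplicative.ofAdd a) = 1 := by
  have hb := maxBlock_surjective hN
  have hM : β.map π * (a : Matrix (Fin N) (Fin N) R).map π =
      (a : Matrix (Fin N) (Fin N) R).map π * β.map π := by
    rw [mem_commuteModRad_iff] at ha
    rw [← Matrix.map_mul, ← Matrix.map_mul]
    ext i j
    have h2 := (hπ _).2 (Ideal.mem_span_singleton.1 (ha i j le_rfl))
    rw [Matrix.sub_apply, map_sub] at h2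
    exact sub_eq_zero.1 h2
  obtain ⟨c, hc, hca⟩ := hreg.exists_lift_commute hϖ hπ hπs hL hL' hM
  have hcβ : β * c = c * β := (Subalgebra.mem_centralizer_iff R).1 hc β rfl
  have hU : unitOneAdd hl hϖ c ∈ congruenceSubgroup (Ideal.span {ϖ}) (maxBlock N) 1 :=
    congruenceSubgroup_mul_le_one hb zero_lt_one hl
      (unitOneAdd_mem hb zero_lt_one hl hϖ (mem_parahoric_maxBlock _ c))
  have hC : unitOneAdd hl hϖ c ∈ matrixCentralizer β := by
    change (unitOneAdd hl hϖ c : Matrix (Fin N) (Fin N) R) * β = β * unitOneAdd hl hϖ c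
    rw [val_unitOneAdd, add_mul, mul_add, one_mul, mul_one, Matrix.smul_mul, Matrix.mul_smul, hcβ]
  have hz : (a : Matrix (Fin N) (Fin N) R) - c ∈ parahoricRad (Ideal.span {ϖ}) (maxBlock N) := by
    intro i j _
    refine Ideal.mem_span_singleton.2 ((hπ _).1 ?_)
    rw [Matrix.sub_apply, map_sub]
    exact sub_eq_zero.2 (congrFun (congrFun hca.symm i) j)
  have h1 : (unitOneAdd hl hϖ c)⁻¹ * unitOneAdd hl hϖ (a : Matrix (Fin N) (Fin N) R) ∈
      congruenceSubgroup (Ideal.span {ϖ}) (maxBlock N) (1 * l + 1) := by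
    refine inv_mul_mem_congruenceSubgroup hb hU hz ?_
    rw [val_unitOneAdd, val_unitOneAdd, smul_sub]
    abel
  have h2 : unitOneAdd hl hϖ (a : Matrix (Fin N) (Fin N) R) ∈
      groupH (Ideal.span {ϖ}) (maxBlock N) β l := by
    rw [← mul_inv_cancel_left (unitOneAdd hl hϖ c)
      (unitOneAdd hl hϖ (a : Matrix (Fin N) (Fin N) R))]
    exact mul_mem (centralizer_le_groupH ⟨hC, hU⟩) (congruenceSubgroup_le_groupH h1)
  exact (QuotientGroup.eq_one_iff (N := (groupH (Ideal.span {ϖ}) (maxBlock N) β l).subgroupOf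
    (groupJ (Ideal.span {ϖ}) (maxBlock N) β l)) ⟨unitOneAdd hl hϖ (a : Matrix (Fin N) (Fin N) R),
      unitOneAdd_mem_groupJ hb zero_lt_one hl hϖ a.2⟩).2 h2

/-- The case `𝔄 = M_N`, for a finite ring `R` with a surjection `π` onto `K` with kernel `(ϖ)`,
where `Λ` plays the role of `a ↦ ψ(ϖ^{-r} a)`. -/
theorem heisenberg_maxBlock (hN : 0 < N) (hl : 0 < l) {p : Ideal R} (hp : p = Ideal.span {ϖ})
    (hreg : IsRegularMatrix β) (hϖ : ϖ ^ (2 * l + 1) = 0) (hπ : ∀ x, π x = 0 ↔ ϖ ∣ x)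
    (hπs : Function.Surjective π)
    (hL : ∀ x, ϖ ^ (2 * l) * x = 0 → ϖ ∣ x) (hL' : ∀ x, ϖ * x = 0 → ϖ ^ (2 * l) ∣ x)
    {Λ : AddChar R ℂ} (hΛ : ∀ a, (∀ y, Λ (ϖ ^ (2 * l) * (a * y)) = 1) → ϖ ∣ a)
    (θ : groupH p (maxBlock N) β l →* ℂˣ)
    (hθ : ∀ g : groupH p (maxBlock N) β l,
      (g : GL (Fin N) R) ∈ congruenceSubgroup p (maxBlock N) (1 * l + 1) →
        (θ g : ℂ) = Λ (β * ((g : GL (Fin N) R) - 1 : Matrix (Fin N) (Fin N) R)).trace) :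
    ∃ (_ : ((groupH p (maxBlock N) β l).subgroupOf (groupJ p (maxBlock N) β l)).Normal)
      (form : _ →* (_ →* ℂˣ)),
      IsCommutatorForm (groupJ p (maxBlock N) β l) (groupH p (maxBlock N) β l) θ form ∧
      (formRadical _ _ form).relIndex (groupJ p (maxBlock N) β l) =
        Nat.card (CentralizerQuotient p (maxBlock N) ⟨β, mem_parahoric_maxBlock _ β⟩) ∧
      form.ker = ⊥ ∧
      UniqueIrreducibleAbove.{u, w} (groupJ p (maxBlock N) β l) _ θ
        (Nat.card K ^ (N * (N - 1) / 2)) := by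
  subst hp
  obtain ⟨hnorm, form, hform, hidx, hker⟩ := exists_commutatorForm_groupJ (maxBlock_surjective hN)
    zero_lt_one hl hϖ (mem_parahoric_maxBlock _ β) hΛ θ hθ
  have hbot : form.ker = ⊥ := by
    rw [eq_bot_iff]
    intro x hx
    obtain ⟨a, ha, rfl⟩ := hker x hx
    exact parahoricToQuotient_maxBlock_eq_one hN hl hreg hϖ hπ hπs hL hL' ha
  have hH : groupH (Ideal.span {ϖ}) (maxBlock N) β l =
      formRadical (groupJ (Ideal.span {ϖ}) (maxBlock N) β l) _ form := by
    ext x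
    rw [mem_formRadical_iff]
    constructor
    · intro hx
      refine ⟨groupH_le_groupJ (maxBlock_surjective hN) zero_lt_one hl hx, ?_⟩
      have h1 : ((⟨x, groupH_le_groupJ (maxBlock_surjective hN) zero_lt_one hl hx⟩ :
          groupJ (Ideal.span {ϖ}) (maxBlock N) β l) : groupJ (Ideal.span {ϖ}) (maxBlock N) β l ⧸
          (groupH (Ideal.span {ϖ}) (maxBlock N) β l).subgroupOf
            (groupJ (Ideal.span {ϖ}) (maxBlock N) β l)) = 1 :=
        (QuotientGroup.eq_one_iff _).2 hx
      rw [h1, map_one]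
    · rintro ⟨hx, h1⟩
      rw [← MonoidHom.mem_ker, hbot, Subgroup.mem_bot] at h1
      exact (QuotientGroup.eq_one_iff (N := (groupH (Ideal.span {ϖ}) (maxBlock N) β l).subgroupOf
        (groupJ (Ideal.span {ϖ}) (maxBlock N) β l)) ⟨x, hx⟩).1 h1
  refine ⟨hnorm, form, hform, hidx.trans (index_commuteModRad _), hbot,
    uniqueIrreducibleAbove_of_eq_formRadical hform hH ⟨le_rfl, fun _ _ _ => rfl⟩ ?_⟩
  conv_rhs => rw [hH]
  rw [hidx]
  exact sq_eq_index_commuteModRad_maxBlock hreg hϖ hπ hπs hL hL'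

section MinBlock

variable {h : ℕ} {m d : Fin h → ℕ} (pos : (Σₗ i : Fin h, Fin (m i) ×ₗ Fin (d i)) ≃o Fin N)

theorem minBlock_apply_pos (i : Fin h) (j : Fin (m i)) (s : Fin (d i)) :
    minBlock pos (pos (toLex ⟨i, toLex (j, s)⟩)) = finSigmaFinEquiv ⟨i, j⟩ := by
  rw [minBlock, OrderIso.symm_apply_apply]
  rfl

/-- The coordinates of the `j`-th block of type `i`. -/
noncomputable def minBlockFiber (i : Fin h) (j : Fin (m i)) :
    Fin (d i) ≃ {x // minBlock pos x = finSigmaFinEquiv ⟨i, j⟩} :=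
  Equiv.ofBijective (fun s => ⟨pos (toLex ⟨i, toLex (j, s)⟩), minBlock_apply_pos pos i j s⟩) <| by
    constructor
    · intro s t hst
      have h1 := pos.injective (congrArg Subtype.val hst)
      have h2 := eq_of_heq (Sigma.mk.inj_iff.1 (toLex.injective h1)).2
      exact (Prod.mk.inj (toLex.injective h2)).2
    · rintro ⟨x, hx⟩
      obtain ⟨⟨i', js⟩, rfl⟩ := pos.surjective x
      obtain ⟨j', s⟩ := js
      have h1 := finSigmaFinEquiv.injective ((minBlock_apply_pos pos i' j' s).symm.trans hx)
      obtain ⟨rfl, h2⟩ := Sigma.mk.inj_iff.1 h1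
      obtain rfl := eq_of_heq h2
      exact ⟨s, rfl⟩

theorem minBlock_surjective (hd : ∀ i, 0 < d i) : Function.Surjective (minBlock pos) := by
  intro z
  obtain ⟨⟨i, j⟩, rfl⟩ := finSigmaFinEquiv.surjective z
  exact ⟨_, minBlock_apply_pos pos i j ⟨0, hd i⟩⟩

variable {pos}

omit [Finite R] in
/-- The index is `∏ i, q ^ (m i * (d i ^ 2 - d i))`, as the centraliser of a block of type `i` has
`q ^ (d i)` elements. -/
theorem sq_eq_index_commuteModRad_minBlock (hπ : ∀ x, π x = 0 ↔ ϖ ∣ x)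
    (hπs : Function.Surjective π) (hβ : β ∈ parahoric (Ideal.span {ϖ}) (minBlock pos))
    (B : (i : Fin h) → Matrix (Fin (d i)) (Fin (d i)) K) (hB : ∀ i, Irreducible (B i).charpoly)
    (hblocks : ∀ (i : Fin h) (j : Fin (m i)) (s t : Fin (d i)),
      π (β (pos (toLex ⟨i, toLex (j, s)⟩)) (pos (toLex ⟨i, toLex (j, t)⟩))) = B i s t) :
    (∏ i, Nat.card K ^ (d i * m i * (d i - 1) / 2)) ^ 2 = (commuteModRad hβ).index := by
  have h1 := index_commuteModRad_mul_prod hπ hπs hβ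
  have hcard : ∀ i j, Fintype.card {x // minBlock pos x = finSigmaFinEquiv ⟨i, j⟩} = d i := by
    intro i j
    rw [← Fintype.card_congr (minBlockFiber pos i j), Fintype.card_fin]
  have hcent : ∀ i j, Nat.card (Subalgebra.centralizer K
      {(β.map π).toSquareBlock (minBlock pos) (finSigmaFinEquiv ⟨i, j⟩)}) = Nat.card K ^ d i := by
    intro i j
    rw [Matrix.card_centralizer_of_irreducible_charpoly, hcard]
    have h2 : Matrix.reindex (minBlockFiber pos i j) (minBlockFiber pos i j) (B i) =
        (β.map π).toSquareBlock (minBlock pos) (finSigmaFinEquiv ⟨i, j⟩) := by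
      rw [← Equiv.eq_symm_apply]
      ext s t
      exact (hblocks i j s t).symm
    rw [← h2, Matrix.charpoly_reindex]
    exact hB i
  rw [← finSigmaFinEquiv.prod_comp, ← finSigmaFinEquiv.prod_comp, Fintype.prod_sigma,
    Fintype.prod_sigma] at h1
  simp only [hcard, hcent, Finset.prod_const, Finset.card_univ, Fintype.card_fin] at h1
  refine Nat.eq_of_mul_eq_mul_right (Finset.prod_pos fun i _ =>
    pow_pos (pow_pos (Nat.card_pos (α := K)) (d i)) (m i)) (Eq.trans ?_ h1.symm)
  rw [← Finset.prod_pow, ← Finset.prod_mul_distrib]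
  refine Finset.prod_congr rfl fun i _ => ?_
  rw [← pow_mul, ← pow_mul, ← pow_mul, ← pow_add, mul_comm _ 2, two_mul_mul_triangle_add]

/-- The case of the minimal `𝔄`, over an abstract ring `R` as in `heisenberg_maxBlock`. -/
theorem heisenberg_minBlock (hN : 0 < N) (hl : 0 < l) {p : Ideal R} (hp : p = Ideal.span {ϖ})
    (hϖ : ϖ ^ (2 * l + 1) = 0) (hπ : ∀ x, π x = 0 ↔ ϖ ∣ x) (hπs : Function.Surjective π)
    {Λ : AddChar R ℂ} (hΛ : ∀ a, (∀ y, Λ (ϖ ^ (2 * l) * (a * y)) = 1) → ϖ ∣ a)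
    (hd : ∀ i, 0 < d i) (hβ : β ∈ parahoric p (minBlock pos))
    (B : (i : Fin h) → Matrix (Fin (d i)) (Fin (d i)) K) (hB : ∀ i, Irreducible (B i).charpoly)
    (hblocks : ∀ (i : Fin h) (j : Fin (m i)) (s t : Fin (d i)),
      π (β (pos (toLex ⟨i, toLex (j, s)⟩)) (pos (toLex ⟨i, toLex (j, t)⟩))) = B i s t)
    (θ : groupH p (minBlock pos) β l →* ℂˣ)
    (hθ : ∀ g : groupH p (minBlock pos) β l,
      (g : GL (Fin N) R) ∈ congruenceSubgroup p (minBlock pos) ((∑ i, m i) * l + 1) →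
        (θ g : ℂ) = Λ (β * ((g : GL (Fin N) R) - 1 : Matrix (Fin N) (Fin N) R)).trace) :
    ∃ (_ : ((groupH p (minBlock pos) β l).subgroupOf (groupJ p (minBlock pos) β l)).Normal)
      (form : _ →* (_ →* ℂˣ)),
      IsCommutatorForm (groupJ p (minBlock pos) β l) (groupH p (minBlock pos) β l) θ form ∧
      (formRadical _ _ form).relIndex (groupJ p (minBlock pos) β l) =
        Nat.card (CentralizerQuotient p (minBlock pos) ⟨β, hβ⟩) ∧
      ∀ θ' : formRadical _ _ form →* ℂˣ, ExtendsCharacter θ θ' →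
        UniqueIrreducibleAbove.{u, w} (groupJ p (minBlock pos) β l) _ θ'
          (∏ i, Nat.card K ^ (d i * m i * (d i - 1) / 2)) := by
  subst hp
  obtain ⟨hnorm, form, hform, hidx, -⟩ := exists_commutatorForm_groupJ
    (minBlock_surjective pos hd) (Fin.pos (minBlock pos ⟨0, hN⟩)) hl hϖ hβ hΛ θ hθ
  exact ⟨hnorm, form, hform, hidx.trans (index_commuteModRad _), fun θ' hθ' =>
    uniqueIrreducibleAbove_of_eq_formRadical hform rfl hθ'
      ((sq_eq_index_commuteModRad_minBlock hπ hπs hβ B hB hblocks).trans hidx.symm)⟩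

end MinBlock

end Abstract

/-! ### The ring `𝔬 / 𝔭 ^ r` -/

section DVR

open IsLocalRing

variable {O : Type*} [CommRing O] [IsDomain O] [IsDiscreteValuationRing O] {ϖ : O} {r : ℕ}

theorem truncRing_mk_eq_zero_iff (hϖ : Irreducible ϖ) {a : O} :
    Ideal.Quotient.mk (maximalIdeal O ^ r) a = 0 ↔ ϖ ^ r ∣ a := by
  rw [Ideal.Quotient.eq_zero_iff_mem, hϖ.maximalIdeal_eq, Ideal.span_singleton_pow,
    Ideal.mem_span_singleton]

theorem truncIdeal_eq_span (hϖ : Irreducible ϖ) :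
    truncIdeal O r = Ideal.span {Ideal.Quotient.mk (maximalIdeal O ^ r) ϖ} := by
  refine (congrArg (Ideal.map (Ideal.Quotient.mk (maximalIdeal O ^ r)))
    hϖ.maximalIdeal_eq).trans ?_
  rw [Ideal.map_span, Set.image_singleton]

theorem truncReduce_eq_zero_iff (hϖ : Irreducible ϖ) (hr : r ≠ 0) (x : TruncRing O r) :
    truncReduce O hr x = 0 ↔ Ideal.Quotient.mk (maximalIdeal O ^ r) ϖ ∣ x := by
  obtain ⟨a, rfl⟩ := Ideal.Quotient.mk_surjective x
  have h1 : Ideal.Quotient.mk (maximalIdeal O) a = 0 ↔ ϖ ∣ a := by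
    rw [Ideal.Quotient.eq_zero_iff_mem, hϖ.maximalIdeal_eq, Ideal.mem_span_singleton]
  refine h1.trans ⟨fun h => map_dvd _ h, ?_⟩
  rintro ⟨y, hy⟩
  obtain ⟨c, rfl⟩ := Ideal.Quotient.mk_surjective y
  rw [← map_mul, ← sub_eq_zero, ← map_sub, truncRing_mk_eq_zero_iff hϖ] at hy
  have h2 := dvd_add ((dvd_pow_self ϖ hr).trans hy) (dvd_mul_right ϖ c)
  rwa [sub_add_cancel] at h2

theorem truncReduce_surjective (hr : r ≠ 0) : Function.Surjective (truncReduce O hr) :=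
  Ideal.Quotient.factor_surjective _

/-- In `𝔬 / 𝔭 ^ (j + k)`, the annihilator of `ϖ ^ j` is generated by `ϖ ^ k`. -/
theorem pow_dvd_of_pow_mul_eq_zero (hϖ : Irreducible ϖ) {j k : ℕ} (hjk : j + k = r)
    {x : TruncRing O r} (hx : Ideal.Quotient.mk (maximalIdeal O ^ r) ϖ ^ j * x = 0) :
    Ideal.Quotient.mk (maximalIdeal O ^ r) ϖ ^ k ∣ x := by
  obtain ⟨a, rfl⟩ := Ideal.Quotient.mk_surjective x
  rw [← map_pow, ← map_mul, truncRing_mk_eq_zero_iff hϖ, ← hjk, pow_add] at hx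
  rw [← map_pow]
  exact map_dvd _ ((mul_dvd_mul_iff_left (pow_ne_zero _ hϖ.ne_zero)).1 hx)

variable {F : Type*} [Field F] [Algebra O F] [FaithfulSMul O F] {ψ : AddChar F ℂ}

theorem psiTrunc_mk (hϖ : Irreducible ϖ) (hψ : ∀ x : O, ψ (algebraMap O F x) = 1) (a : O) :
    psiTrunc ψ ϖ r (Ideal.Quotient.mk (maximalIdeal O ^ r) a) =
      ψ (algebraMap O F a / algebraMap O F ϖ ^ r) := by
  rw [psiTrunc]
  set s := Function.surjInv Ideal.Quotient.mk_surjective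
    (Ideal.Quotient.mk (maximalIdeal O ^ r) a)
  have h1 : Ideal.Quotient.mk (maximalIdeal O ^ r) (s - a) = 0 := by
    rw [map_sub, sub_eq_zero]
    exact Function.surjInv_eq Ideal.Quotient.mk_surjective _
  obtain ⟨c, hc⟩ := (truncRing_mk_eq_zero_iff hϖ).1 h1
  have h0 : algebraMap O F ϖ ^ r ≠ 0 := pow_ne_zero _
    ((map_ne_zero_iff _ (FaithfulSMul.algebraMap_injective O F)).2 hϖ.ne_zero)
  have h2 : algebraMap O F s / algebraMap O F ϖ ^ r =
      algebraMap O F a / algebraMap O F ϖ ^ r + algebraMap O F c := by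
    rw [sub_eq_iff_eq_add'.1 hc, map_add, map_mul, map_pow, add_div, mul_div_cancel_left₀ _ h0]
  rw [h2, AddChar.map_add_eq_mul, hψ, mul_one]

/-- The function `a ↦ ψ(ϖ^{-r} a)` as an additive character of `𝔬_r`. -/
noncomputable def truncAddChar (hϖ : Irreducible ϖ) (hψ : ∀ x : O, ψ (algebraMap O F x) = 1)
    (r : ℕ) : AddChar (TruncRing O r) ℂ where
  toFun := psiTrunc ψ ϖ r
  map_zero_eq_one' := by
    rw [← map_zero (Ideal.Quotient.mk (maximalIdeal O ^ r)), psiTrunc_mk hϖ hψ, map_zero, zero_div,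
      AddChar.map_zero_eq_one]
  map_add_eq_mul' x y := by
    obtain ⟨a, rfl⟩ := Ideal.Quotient.mk_surjective x
    obtain ⟨c, rfl⟩ := Ideal.Quotient.mk_surjective y
    rw [← map_add, psiTrunc_mk hϖ hψ, psiTrunc_mk hϖ hψ, psiTrunc_mk hϖ hψ, map_add, add_div,
      AddChar.map_add_eq_mul]

theorem dvd_of_forall_truncAddChar (hϖ : Irreducible ϖ)
    (hψ : ∀ x : O, ψ (algebraMap O F x) = 1)
    (hψ' : ∃ x : O, ψ (algebraMap O F x / algebraMap O F ϖ) ≠ 1) {L : ℕ} (hL : L + 1 = r)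
    {a : TruncRing O r} (ha : ∀ y, truncAddChar hϖ hψ r
      (Ideal.Quotient.mk (maximalIdeal O ^ r) ϖ ^ L * (a * y)) = 1) :
    Ideal.Quotient.mk (maximalIdeal O ^ r) ϖ ∣ a := by
  obtain ⟨c, rfl⟩ := Ideal.Quotient.mk_surjective a
  by_contra hnd
  have hc : IsUnit c := by
    by_contra hc
    refine hnd (map_dvd _ ?_)
    have h1 : c ∈ maximalIdeal O := (mem_maximalIdeal c).2 hc
    rwa [hϖ.maximalIdeal_eq, Ideal.mem_span_singleton] at h1
  obtain ⟨x, hx⟩ := hψ'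
  obtain ⟨c, rfl⟩ := hc
  refine hx ?_
  have h1 := ha (Ideal.Quotient.mk (maximalIdeal O ^ r) ((c⁻¹ : Oˣ) * x))
  rw [← map_pow, ← map_mul, ← map_mul, Units.mul_inv_cancel_left] at h1
  have h2 := (psiTrunc_mk (r := r) hϖ hψ (ϖ ^ L * x)).symm.trans h1
  have h0 : algebraMap O F ϖ ≠ 0 :=
    (map_ne_zero_iff _ (FaithfulSMul.algebraMap_injective O F)).2 hϖ.ne_zero
  rw [← hL, map_mul, map_pow, pow_succ, mul_div_mul_left _ _ (pow_ne_zero _ h0)] at h2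
  exact h2

end DVR

theorem mainTheorem3 {F : Type u} [Field F] [ValuativeRel F] [TopologicalSpace F]
    [IsNonarchimedeanLocalField F]
    -- a uniformiser and an additive character of conductor `𝔬`
    (ϖ : 𝒪[F]) (hϖ : Irreducible ϖ)
    (ψ : AddChar F ℂ) (hψ : ∀ x : 𝒪[F], ψ (x : F) = 1)
    (hψ' : ∃ x : 𝒪[F], ψ ((x : F) / (ϖ : F)) ≠ 1)
    (N : ℕ) (hN : 0 < N)
    (r : ℕ) (hr : 3 ≤ r) (hodd : Odd r)
    -- a regular matrix `β` over `𝔬_r`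
    (β : Matrix (Fin N) (Fin N) (TruncRing 𝒪[F] r)) (hreg : IsRegularMatrix β)
    -- the factorisation of the characteristic polynomial of its reduction
    (h : ℕ) (f : Fin h → Polynomial 𝓀[F]) (m d : Fin h → ℕ)
    (hfmonic : ∀ i, (f i).Monic) (hfirr : ∀ i, Irreducible (f i)) (hfinj : Function.Injective f)
    (hm : ∀ i, 0 < m i) (hd : ∀ i, (f i).natDegree = d i)
    (hchar : (β.map (truncReduce 𝒪[F] (Nat.ne_zero_of_lt hr))).charpoly = ∏ i, f i ^ m i)
    -- `β` lies in `𝔄_m`, and its image in `𝔄_m / 𝔓_m` is block diagonal, with `m i` equal blocks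
    -- of characteristic polynomial `f i` for every `i`
    (pos : (Σₗ i : Fin h, Fin (m i) ×ₗ Fin (d i)) ≃o Fin N)
    (hβmin : β ∈ parahoric (truncIdeal 𝒪[F] r) (minBlock pos))
    (B : (i : Fin h) → Matrix (Fin (d i)) (Fin (d i)) 𝓀[F]) (hB : ∀ i, (B i).charpoly = f i)
    (hblocks : ∀ (i : Fin h) (j : Fin (m i)) (s t : Fin (d i)),
      truncReduce 𝒪[F] (Nat.ne_zero_of_lt hr)
        (β (pos (toLex ⟨i, toLex (j, s)⟩)) (pos (toLex ⟨i, toLex (j, t)⟩))) = B i s t) :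
    -- the case `𝔄 = 𝔄_M`
    (∀ θ : groupH (truncIdeal 𝒪[F] r) (maxBlock N) β (r / 2) →* ℂˣ,
      ExtendsPsiBeta ψ ϖ r (maxBlock N) β (r / 2) θ →
      ∃ (_ : ((groupH (truncIdeal 𝒪[F] r) (maxBlock N) β (r / 2)).subgroupOf
            (groupJ (truncIdeal 𝒪[F] r) (maxBlock N) β (r / 2))).Normal)
        (form : _ →* (_ →* ℂˣ)),
        IsCommutatorForm (groupJ (truncIdeal 𝒪[F] r) (maxBlock N) β (r / 2))
          (groupH (truncIdeal 𝒪[F] r) (maxBlock N) β (r / 2)) θ form ∧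
        (formRadical _ _ form).relIndex (groupJ (truncIdeal 𝒪[F] r) (maxBlock N) β (r / 2)) =
          Nat.card (CentralizerQuotient (truncIdeal 𝒪[F] r) (maxBlock N) ⟨β, mem_parahoric_maxBlock _ β⟩) ∧
        form.ker = ⊥ ∧
        UniqueIrreducibleAbove.{u, w} (groupJ (truncIdeal 𝒪[F] r) (maxBlock N) β (r / 2)) _ θ
          (Nat.card 𝓀[F] ^ (N * (N - 1) / 2))) ∧
    -- the case `𝔄 = 𝔄_m`
    (∀ θ : groupH (truncIdeal 𝒪[F] r) (minBlock pos) β (r / 2) →* ℂˣ,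
      ExtendsPsiBeta ψ ϖ r (minBlock pos) β (r / 2) θ →
      ∃ (_ : ((groupH (truncIdeal 𝒪[F] r) (minBlock pos) β (r / 2)).subgroupOf
            (groupJ (truncIdeal 𝒪[F] r) (minBlock pos) β (r / 2))).Normal)
        (form : _ →* (_ →* ℂˣ)),
        IsCommutatorForm (groupJ (truncIdeal 𝒪[F] r) (minBlock pos) β (r / 2))
          (groupH (truncIdeal 𝒪[F] r) (minBlock pos) β (r / 2)) θ form ∧
        (formRadical _ _ form).relIndex (groupJ (truncIdeal 𝒪[F] r) (minBlock pos) β (r / 2)) =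
          Nat.card (CentralizerQuotient (truncIdeal 𝒪[F] r) (minBlock pos) ⟨β, hβmin⟩) ∧
        ∀ θ' : formRadical _ _ form →* ℂˣ, ExtendsCharacter θ θ' →
          UniqueIrreducibleAbove.{u, w} (groupJ (truncIdeal 𝒪[F] r) (minBlock pos) β (r / 2))
            _ θ' (∏ i, Nat.card 𝓀[F] ^ (d i * m i * (d i - 1) / 2))) := by
  have hl : 0 < r / 2 := by omega
  have hr2 : 2 * (r / 2) + 1 = r := Nat.two_mul_div_two_add_one_of_odd hodd
  have hr0 : r ≠ 0 := Nat.ne_zero_of_lt hr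
  have hϖr : (Ideal.Quotient.mk (IsLocalRing.maximalIdeal 𝒪[F] ^ r) ϖ) ^ (2 * (r / 2) + 1) = 0 := by
    rw [hr2, ← map_pow, truncRing_mk_eq_zero_iff hϖ]
  have hL : ∀ x, (Ideal.Quotient.mk (IsLocalRing.maximalIdeal 𝒪[F] ^ r) ϖ) ^ (2 * (r / 2)) * x = 0 →
      Ideal.Quotient.mk (IsLocalRing.maximalIdeal 𝒪[F] ^ r) ϖ ∣ x := fun x hx => by
    simpa using pow_dvd_of_pow_mul_eq_zero hϖ hr2 hx
  have hL' : ∀ x, Ideal.Quotient.mk (IsLocalRing.maximalIdeal 𝒪[F] ^ r) ϖ * x = 0 →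
      (Ideal.Quotient.mk (IsLocalRing.maximalIdeal 𝒪[F] ^ r) ϖ) ^ (2 * (r / 2)) ∣ x :=
    fun x hx => pow_dvd_of_pow_mul_eq_zero (j := 1) hϖ (by omega) (by rwa [pow_one])
  have hΛ := fun a => dvd_of_forall_truncAddChar (F := F) (a := a) hϖ hψ hψ' hr2
  refine ⟨fun θ hθ => ?_, fun θ hθ => ?_⟩
  · exact heisenberg_maxBlock hN hl (truncIdeal_eq_span hϖ) hreg hϖr
      (truncReduce_eq_zero_iff hϖ hr0) (truncReduce_surjective hr0) hL hL' hΛ θ hθ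
  · refine heisenberg_minBlock hN hl (truncIdeal_eq_span hϖ) hϖr
      (truncReduce_eq_zero_iff hϖ hr0) (truncReduce_surjective hr0) hΛ (fun i => ?_) hβmin B
      (fun i => ?_) hblocks θ hθ
    · rw [← hd i]
      exact (hfirr i).natDegree_pos
    · rw [hB i]
      exact hfirr i
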